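/- **Decision region determination.** An instance consists of $m$ hypotheses $[m]$ with probabilities $p_1,\dots,p_m\ge 0$ summing to $1$; tests $U$, $|U|=n$, where test $e$ has cost $c_e>0$ and is positive exactly on a set of hypotheses; and $k$ decision regions $D_1,\dots,D_k\subsetneq[m]$. It is assumed that for every $i$ there is a region $D_j$ that contains all the hypotheses having the same outcomes as $i$ on all tests of $U$. An (adaptive) policy is a binary decision tree whose inner nodes perform tests, branching on the outcome, and whose leaves report a region. It is feasible if for every true hypothesis $i$ it reports a region containing $i$; its expected cost is $\sum_i p_i\cdot(\text{total cost of the tests performed when } i \text{ is true})$. Let $r=\max_i|\{j: i\in D_j\}|$. For $e\in U$, $i\in[m]$ let $T_e(i)$ be the set of hypotheses whose outcome on $e$ differs from that of $i$. For $S\subseteq U$ and $i\in D_j$ put $$f_{i,j}(S)=\frac{\left|\bigcup_{e\in S}(T_e(i)\cap D_j^c)\right|}{|D_j^c|},\qquad f_i(S)=1-\prod_{j:\,i\in D_j}\bigl(1-f_{i,j}(S)\bigr).$$ The greedy algorithm does the following. When the tests $E$ have been performed, let $H$ be the set of hypotheses $i$ that are compatible with the observed outcomes and uncovered, i.e. $f_i(E)<1$.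 If $H\ne\emptyset$, perform a test $e\in U\setminus E$ that maximizes $$\frac1{c_e}\Bigl(\sum_{i\in L_e(H)}p_i+\sum_{i\in H}p_i\,\frac{f_i(E\cup\{e\})-f_i(E)}{1-f_i(E)}\Bigr),$$ where $L_e(H)$ is the smaller of the two sets of hypotheses in $H$ on which $e$ is positive, resp. negative (ties broken arbitrarily). If $H=\emptyset$, stop and report a region containing all compatible hypotheses. There are absolute constants $C,c$ such that for every instance the following holds. 1. Every $f_i$ is monotone and submodular on $2^U$, has values in $[0,1]$, and satisfies $f_i(\emptyset)=0$, $f_i(U)=1$. (So, with the given probabilities and costs and with feedback given by the test outcomes, these functions form an instance of adaptive submodular ranking.) Moreover $f_i(S)=1$ if and only if some region $D_j\ni i$ contains all hypotheses that agree with $i$ on the tests in $S$. 2. The parameter $\epsilon=\min\{f_i(S\cup\{e\})-f_i(S): i\in[m],\,S\subseteq U,\,e\in U,\,f_i(S\cup\{e\})>f_i(S)\}$ satisfies $\epsilon\ge m^{-r}$. 3. Every policy produced by the greedy algorithm, however ties are broken, is feasible and has expected cost at most $C\,r\log m$ times the expected cost of any feasible policy. 4. There is one fixed program for a random access machine with real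 arithmetic (unit cost per operation), interacting with the true hypothesis only by performing tests, that on every instance carries out a policy produced by the greedy algorithm and makes at most $c\,(m+n+k)^c$ steps in total; if all regions are non-empty (so that $k\le mr$), it makes at most $c\,(m+n+r)^c$ steps. In particular the running time is polynomial, not exponential, in $m$ and $r$ (and the number $n$ of tests). -/

import Mathlib

noncomputable section

/-! ## Adaptive submodular ranking -/

/-- The data of an adaptive submodular ranking instance with `m` scenarios and `n` elements. -/
structure ASR (m n : ℕ) where
  /-- the interest set of each scenario: the elements on which it gives positive feedback -/
  interest : Fin m → Finset (Fin n)
  /-- the utility function of each scenario -/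
  f : Fin m → Finset (Fin n) → ℝ
  p : Fin m → ℝ
  cost : Fin n → ℝ

namespace ASR

variable {m n : ℕ} (A : ASR m n)

/-- The requirements on an instance: a probability distribution, positive costs, and normalized
monotone submodular functions with values in `[0, 1]`. -/
structure IsInstance : Prop where
  p_nonneg : ∀ i, 0 ≤ A.p i
  p_sum : ∑ i, A.p i = 1
  cost_pos : ∀ e, 0 < A.cost e
  f_mem : ∀ i S, A.f i S ∈ Set.Icc (0 : ℝ) 1
  f_empty : ∀ i, A.f i ∅ = 0
  f_univ : ∀ i, A.f i Finset.univ = 1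
  f_mono : ∀ i, ∀ S S' : Finset (Fin n), S ⊆ S' → A.f i S ≤ A.f i S'
  f_submod : ∀ i, ∀ S S' : Finset (Fin n),
    A.f i (S ∩ S') + A.f i (S ∪ S') ≤ A.f i S + A.f i S'

/-- The parameter `ε`: the smallest positive increment of a utility function when one element
is added. -/
def minIncrement : ℝ :=
  sInf {x : ℝ | ∃ (i : Fin m) (S : Finset (Fin n)) (e : Fin n),
    A.f i S < A.f i (insert e S) ∧ x = A.f i (insert e S) - A.f i S}

/-- The scenarios of `H` with positive feedback on `e`. -/
def yesPart (H : Finset (Fin m)) (e : Fin n) : Finset (Fin m) :=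
  H.filter fun i => e ∈ A.interest i

/-- The scenarios of `H` with negative feedback on `e`. -/
def noPart (H : Finset (Fin m)) (e : Fin n) : Finset (Fin m) :=
  H.filter fun i => e ∉ A.interest i

/-- `L` is a side of minimum cardinality of the split of `H` by `e` (either one in a tie). -/
def IsMinSide (H : Finset (Fin m)) (e : Fin n) (L : Finset (Fin m)) : Prop :=
  (L = A.yesPart H e ∧ (A.yesPart H e).card ≤ (A.noPart H e).card) ∨
  (L = A.noPart H e ∧ (A.noPart H e).card ≤ (A.yesPart H e).card)

/-- The greedy score of `e` at the state `(E, H)`, where `L` is the smaller side of the split of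
`H` by `e`. -/
def score (E : Finset (Fin n)) (H : Finset (Fin m)) (e : Fin n) (L : Finset (Fin m)) : ℝ :=
  1 / A.cost e * (∑ j ∈ L, A.p j +
    ∑ i ∈ H, A.p i * ((A.f i (insert e E) - A.f i E) / (1 - A.f i E)))

/-- `e` is a possible choice of the greedy algorithm at the state `(E, H)`: among the elements
outside `E`, it has maximum score (for some way of breaking ties between the two sides). -/
def IsGreedyChoice (E : Finset (Fin n)) (H : Finset (Fin m)) (e : Fin n) : Prop :=
  e ∉ E ∧ ∃ L : Fin n → Finset (Fin m),
    (∀ e', e' ∉ E → A.IsMinSide H e' (L e')) ∧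
    ∀ e', e' ∉ E → A.score E H e' (L e') ≤ A.score E H e (L e)

/-- The scenarios of `K` that are not covered by `E`. -/
def uncovered (E : Finset (Fin n)) (K : Finset (Fin m)) : Finset (Fin m) :=
  K.filter fun i => A.f i E ≠ 1

end ASR

/-! ## Decision region determination -/

/-- A decision region determination instance with `m` hypotheses, `n` tests and `k` decision
regions. No region is the set of all hypotheses, and the outcomes of all tests together determine
a region that contains the true hypothesis. -/
structure DRD (m n k : ℕ) where
  p : Fin m → ℝ
  /-- the hypotheses for which each test is positive -/
  test : Fin n → Finset (Fin m)
  cost : Fin n → ℝ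
  region : Fin k → Finset (Fin m)
  p_nonneg : ∀ i, 0 ≤ p i
  p_sum : ∑ i, p i = 1
  cost_pos : ∀ e, 0 < cost e
  region_ne_univ : ∀ j, region j ≠ Finset.univ
  feasible : ∀ i, ∃ j, ∀ h, (∀ e, h ∈ test e ↔ i ∈ test e) → h ∈ region j

/-- Adaptive policies, as decision trees: report a region, or perform a test and continue
depending on its outcome. -/
inductive Policy (n k : ℕ) where
  | report (j : Fin k) : Policy n k
  | query (e : Fin n) (yes no : Policy n k) : Policy n k

namespace Policy

variable {n k : ℕ}

/-- The tests performed when the outcomes are given by `ans`. -/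
def path : Policy n k → (Fin n → Bool) → List (Fin n)
  | report _, _ => []
  | query e yes no, ans => e :: (if ans e then yes.path ans else no.path ans)

/-- The region reported when the outcomes are given by `ans`. -/
def decision : Policy n k → (Fin n → Bool) → Fin k
  | report j, _ => j
  | query e yes no, ans => if ans e then yes.decision ans else no.decision ans

end Policy

namespace DRD

variable {m n k : ℕ} (I : DRD m n k)

/-- The outcome of test `e` under hypothesis `i`. -/
def outcome (i : Fin m) (e : Fin n) : Bool := decide (i ∈ I.test e)

/-- The maximum number of regions that contain a hypothesis. -/
def maxOverlap : ℕ :=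
  Finset.univ.sup fun i : Fin m => (Finset.univ.filter fun j => i ∈ I.region j).card

/-- `T_e(i)`: the hypotheses that differ from `i` on test `e`. -/
def differ (e : Fin n) (i : Fin m) : Finset (Fin m) :=
  Finset.univ.filter fun h => I.outcome h e ≠ I.outcome i e

/-- The hypotheses that agree with `i` on all tests of `S`. -/
def compatible (i : Fin m) (S : Finset (Fin n)) : Finset (Fin m) :=
  Finset.univ.filter fun h => ∀ e ∈ S, I.outcome h e = I.outcome i e

/-- `f_{i,j}(S)`: the fraction of the complement of region `j` ruled out by `S` under `i`. -/
def regionFun (i : Fin m) (j : Fin k) (S : Finset (Fin n)) : ℝ :=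
  ((S.biUnion fun e => I.differ e i ∩ (I.region j)ᶜ).card : ℝ) / ((I.region j)ᶜ.card : ℝ)

/-- The OR-combination `f_i` of the functions `f_{i,j}` over the regions `j` containing `i`. -/
def orFun (i : Fin m) (S : Finset (Fin n)) : ℝ :=
  1 - ∏ j ∈ Finset.univ.filter (fun j => i ∈ I.region j), (1 - I.regionFun i j S)

/-- The adaptive submodular ranking instance built from the OR-combinations. -/
def toASR : ASR m n where
  interest i := Finset.univ.filter fun e => i ∈ I.test e
  f := I.orFun
  p := I.p
  cost := I.cost

/-- The policy always reports a region that contains the true hypothesis. -/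
def IsFeasible (T : Policy n k) : Prop :=
  ∀ i, i ∈ I.region (T.decision (I.outcome i))

/-- Expected cost of the tests that a policy performs. -/
def expectedCost (T : Policy n k) : ℝ :=
  ∑ i, I.p i * ((T.path (I.outcome i)).map I.cost).sum

/-- `I.IsGreedy E K T`: the decision tree `T` is a run of the greedy algorithm for `I.toASR` from
the node at which the tests `E` have been performed and `K` is the set of hypotheses compatible
with their outcomes. As long as `K` has an uncovered hypothesis a greedy choice is performed;
otherwise a region containing all of `K` is reported. -/
inductive IsGreedy : Finset (Fin n) → Finset (Fin m) → Policy n k → Prop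
  | report (E : Finset (Fin n)) (K : Finset (Fin m)) (j : Fin k)
      (hcov : I.toASR.uncovered E K = ∅) (hj : K ⊆ I.region j) :
      IsGreedy E K (Policy.report j)
  | query (E : Finset (Fin n)) (K : Finset (Fin m)) (e : Fin n) (yes no : Policy n k)
      (hunc : (I.toASR.uncovered E K).Nonempty)
      (he : I.toASR.IsGreedyChoice E (I.toASR.uncovered E K) e)
      (hyes : IsGreedy (insert e E) (I.toASR.yesPart K e) yes)
      (hno : IsGreedy (insert e E) (I.toASR.noPart K e) no) :
      IsGreedy E K (Policy.query e yes no)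

/-- A decision tree that the greedy algorithm can produce. -/
def IsGreedyPolicy (T : Policy n k) : Prop := I.IsGreedy ∅ Finset.univ T

end DRD

/-! ## Machine model

A random access machine over the real numbers with unit costs. The memory consists of
two-dimensional arrays of natural numbers and of real numbers. On natural numbers (used as
addresses and counters) it adds, subtracts and compares; on reals it performs the four arithmetic
operations and compares. Besides, it can perform a test on the hidden true hypothesis, which is
accessible in no other way. -/

namespace RealRAM

/-- The state of the machine, with the list of the tests performed so far and the number of
elementary steps made so far. -/
structure State where
  nat : ℕ → ℕ → ℕ → ℕ
  real : ℕ → ℕ → ℕ → ℝ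
  log : List ℕ
  steps : ℕ

/-- Natural-number expressions; `read a i j` is the entry `(i, j)` of the array `a`. -/
inductive NatExpr where
  | const (c : ℕ)
  | read (a : ℕ) (i j : NatExpr)
  | add (x y : NatExpr)
  | sub (x y : NatExpr)

namespace NatExpr

/-- The value of an expression (subtraction is truncated at `0`). -/
def eval (s : State) : NatExpr → ℕ
  | const c => c
  | read a i j => s.nat a (i.eval s) (j.eval s)
  | add x y => x.eval s + y.eval s
  | sub x y => x.eval s - y.eval s

/-- The number of operations in an expression. -/
def time : NatExpr → ℕ
  | const _ => 1
  | read _ i j => i.time + j.time + 1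
  | add x y => x.time + y.time + 1
  | sub x y => x.time + y.time + 1

end NatExpr

/-- Real expressions. -/
inductive RealExpr where
  | const (c : ℕ)
  | read (a : ℕ) (i j : NatExpr)
  | add (x y : RealExpr)
  | sub (x y : RealExpr)
  | mul (x y : RealExpr)
  | div (x y : RealExpr)

namespace RealExpr

/-- The value of an expression. -/
def eval (s : State) : RealExpr → ℝ
  | const c => (c : ℝ)
  | read a i j => s.real a (i.eval s) (j.eval s)
  | add x y => x.eval s + y.eval s
  | sub x y => x.eval s - y.eval s
  | mul x y => x.eval s * y.eval s
  | div x y => x.eval s / y.eval s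

/-- The number of operations in an expression. -/
def time : RealExpr → ℕ
  | const _ => 1
  | read _ i j => i.time + j.time + 1
  | add x y => x.time + y.time + 1
  | sub x y => x.time + y.time + 1
  | mul x y => x.time + y.time + 1
  | div x y => x.time + y.time + 1

end RealExpr

/-- Conditions. -/
inductive Cond where
  | natLe (x y : NatExpr)
  | realLe (x y : RealExpr)

namespace Cond

/-- The truth value of a condition. -/
def Holds (s : State) : Cond → Prop
  | natLe x y => x.eval s ≤ y.eval s
  | realLe x y => x.eval s ≤ y.eval s

/-- The number of operations in a condition. -/
def time : Cond → ℕ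
  | natLe x y => x.time + y.time + 1
  | realLe x y => x.time + y.time + 1

end Cond

namespace State

/-- Count `t` further steps. -/
def tick (s : State) (t : ℕ) : State := { s with steps := s.steps + t }

/-- Write the entry `(i, j)` of the natural-number array `a`. -/
def writeNat (s : State) (a i j v : ℕ) : State :=
  { s with nat := fun a' i' j' => if a' = a ∧ i' = i ∧ j' = j then v else s.nat a' i' j' }

/-- Write the entry `(i, j)` of the real array `a`. -/
def writeReal (s : State) (a i j : ℕ) (v : ℝ) : State :=
  { s with real := fun a' i' j' => if a' = a ∧ i' = i ∧ j' = j then v else s.real a' i' j' }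

end State

/-- Programs. `loop a x body` evaluates `x` once and runs `body` that many times, with the entry
`(0, 0)` of the natural-number array `a` set to the number of the current round (from `0`).
`perform a x` performs the test with number `x` and writes its outcome, `1` or `0`, to the entry
`(0, 0)` of the natural-number array `a`. -/
inductive Program where
  | skip
  | setNat (a : ℕ) (i j : NatExpr) (x : NatExpr)
  | setReal (a : ℕ) (i j : NatExpr) (x : RealExpr)
  | seq (P Q : Program)
  | cond (b : Cond) (P Q : Program)
  | loop (a : ℕ) (x : NatExpr) (body : Program)
  | perform (a : ℕ) (x : NatExpr)

open Classical in
/-- Execution of a program, where `ans` gives the outcomes of the tests. Every elementary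
operation and every instruction counts as one step. -/
def Program.exec (ans : ℕ → Bool) : Program → State → State
  | skip, s => s.tick 1
  | setNat a i j x, s =>
      (s.writeNat a (i.eval s) (j.eval s) (x.eval s)).tick (i.time + j.time + x.time + 1)
  | setReal a i j x, s =>
      (s.writeReal a (i.eval s) (j.eval s) (x.eval s)).tick (i.time + j.time + x.time + 1)
  | seq P Q, s => Q.exec ans (P.exec ans (s.tick 1))
  | cond b P Q, s =>
      if b.Holds s then P.exec ans (s.tick (b.time + 1)) else Q.exec ans (s.tick (b.time + 1))
  | loop a x body, s =>
      (List.range (x.eval s)).foldl (fun s' t => body.exec ans ((s'.writeNat a 0 0 t).tick 1))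
        (s.tick (x.time + 1))
  | perform a x, s =>
      { (s.writeNat a 0 0 (if ans (x.eval s) then 1 else 0)).tick (x.time + 1) with
        log := s.log ++ [x.eval s] }

end RealRAM

namespace DRD

variable {m n k : ℕ} (I : DRD m n k)

open Classical in
/-- The initial memory on input `I`. Natural-number arrays: array `0` holds `m`, `n`, `k` in its
entries `(0, 0)`, `(0, 1)`, `(0, 2)`; entry `(e, i)` of array `1` is `1` or `0` according to
whether test `e` is positive for hypothesis `i`; entry `(j, i)` of array `2` is `1` or `0`
according to whether `i` belongs to region `j`. Real arrays: entry `(i, 0)` of array `0` is the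
probability of `i`; entry `(e, 0)` of array `1` is the cost of `e`. All other entries are `0`. -/
def initialState : RealRAM.State where
  nat a x y :=
    if a = 0 ∧ x = 0 ∧ y = 0 then m
    else if a = 0 ∧ x = 0 ∧ y = 1 then n
    else if a = 0 ∧ x = 0 ∧ y = 2 then k
    else if a = 1 ∧ ∃ (e : Fin n) (i : Fin m), x = e ∧ y = i ∧ i ∈ I.test e then 1
    else if a = 2 ∧ ∃ (j : Fin k) (i : Fin m), x = j ∧ y = i ∧ i ∈ I.region j then 1
    else 0
  real a x y :=
    if h : a = 0 ∧ x < m ∧ y = 0 then I.p ⟨x, h.2.1⟩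
    else if h : a = 1 ∧ x < n ∧ y = 0 then I.cost ⟨x, h.2.1⟩
    else 0
  log := []
  steps := 0

/-- The final state of program `P` on input `I` when the true hypothesis is `i`. -/
def run (P : RealRAM.Program) (i : Fin m) : RealRAM.State :=
  P.exec (fun x => if h : x < n then I.outcome i ⟨x, h⟩ else false) I.initialState

/-- On input `I` the program carries out the policy `T`: under every true hypothesis it performs
the tests of `T` in the same order, and it leaves the number of the region that `T` reports in the
entry `(0, 0)` of the natural-number array `3`. -/
def Implements (P : RealRAM.Program) (T : Policy n k) : Prop :=
  ∀ i, (I.run P i).log = (T.path (I.outcome i)).map (fun e => (e : ℕ)) ∧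
    (I.run P i).nat 3 0 0 = (T.decision (I.outcome i) : ℕ)

end DRD

end

noncomputable section

/-! ### Monotonicity, submodularity and increments of the OR-combinations -/

namespace DRD

variable {m n k : ℕ} (I : DRD m n k)

/-! Everything about `f_i` is read off from `1 - f_i(S)`, the product over the regions `D_j ∋ i` of
the fraction of `D_jᶜ` that is still compatible with `i` after `S`. Each factor is nonnegative,
antitone and supermodular in `S`, and these properties survive multiplication. The denominators do
not depend on `S`, so two distinct values of `f_i` differ by at least one over their product, hence
by at least `m ^ (-r)`.

The hypotheses compatible with the outcomes of `E` form a version space `K`. They all have the same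
compatible set, so they become covered simultaneously, and the greedy set `H` is either `K` or
empty.

Approximation: at an uncovered node let `σ` be the greedy score and `p(K)` the mass of `K`. In a
feasible competitor, follow the stem, the path that at every test `e` leaves a side `L` for which
the weight of `L` plus the relative gains at `E` is at most `c_e σ`. A hypothesis of `K` either
leaves the stem, and its probability is counted in some `L`, or it reaches the leaf, where it is
covered; then by submodularity the relative gains of the stem tests add up to at least one. So the
competitor decides mass at most `t σ` at cost at most `t` (`IsVersionSpace.sum_p_le`). With `P =
p(K) / σ`, at most half of `K` is decided at cost at most `P / 2`.

The greedy node itself costs `c_e p(K) = P W`, where `W = c_e σ` is its gain. A potential pays for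
`W` (`IsVersionSpace.gain_add_potential_le`): `log₂ |K|` drops by one on the smaller side, and `1 +
log ((1 - f_i) m ^ r)` drops by the relative gain of `i`. The potential is at most `p(K) Λ` with `Λ
= O(r log m)`. The induction down the greedy tree (`sum_costOf_le`) keeps as price `M` the running
maximum of the values `P`. Raising the price from `M` to `P` costs at most `(P - M) p(K) Λ`, which
is charged to the slice of the competitor's cost between `M / 2` and `P / 2`. Slices on one path are
disjoint, so only a constant factor is lost.

Running time: an explicit program evaluates the scores by nested loops whose bounds are `m`, `n`,
`k`. Only `perform` consults the hidden hypothesis, so the decision tree is recovered by following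
both possible answers at each chosen test (`Greedy.Represents.exists_policy`). -/

theorem mem_compatible {i h : Fin m} {S : Finset (Fin n)} :
    h ∈ I.compatible i S ↔ ∀ e ∈ S, I.outcome h e = I.outcome i e := by
  simp [compatible]

theorem self_mem_compatible (i : Fin m) (S : Finset (Fin n)) : i ∈ I.compatible i S := by
  simp [compatible]

theorem compatible_empty (i : Fin m) : I.compatible i ∅ = Finset.univ := by
  simp [compatible]

theorem compatible_anti (i : Fin m) {S S' : Finset (Fin n)} (h : S ⊆ S') :
    I.compatible i S' ⊆ I.compatible i S := by
  intro x hx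
  rw [mem_compatible] at *
  exact fun e he => hx e (h he)

theorem compatible_union (i : Fin m) (S S' : Finset (Fin n)) :
    I.compatible i (S ∪ S') = I.compatible i S ∩ I.compatible i S' := by
  ext x
  simp only [Finset.mem_inter, mem_compatible, Finset.mem_union]
  exact ⟨fun h => ⟨fun e he => h e (.inl he), fun e he => h e (.inr he)⟩,
    fun h e he => he.elim (h.1 e) (h.2 e)⟩

theorem outcome_eq_iff {h i : Fin m} {e : Fin n} :
    I.outcome h e = I.outcome i e ↔ (h ∈ I.test e ↔ i ∈ I.test e) := by
  simp [outcome]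

theorem card_compl_region_pos (j : Fin k) : 0 < (I.region j)ᶜ.card := by
  rw [Finset.card_pos, Finset.nonempty_iff_ne_empty, Ne, Finset.compl_eq_empty_iff]
  exact I.region_ne_univ j

/-- Outside the region, being ruled out by `S` is the same as being incompatible with `i` on `S`.
This replaces counting unions by counting what remains, the quantity that multiplies in `f_i`. -/
theorem biUnion_differ (i : Fin m) (j : Fin k) (S : Finset (Fin n)) :
    (S.biUnion fun e => I.differ e i ∩ (I.region j)ᶜ) =
      (I.region j)ᶜ \ (I.compatible i S \ I.region j) := by
  ext x
  simp only [Finset.mem_biUnion, Finset.mem_inter, differ, Finset.mem_filter, Finset.mem_univ,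
    true_and, Finset.mem_compl, Finset.mem_sdiff, mem_compatible]
  constructor
  · rintro ⟨e, he, h1, h2⟩
    exact ⟨h2, fun h => h1 (h.1 e he)⟩
  · rintro ⟨h2, h⟩
    by_contra hc
    push Not at hc
    refine h ⟨fun e he => ?_, h2⟩
    by_contra h3
    exact h2 (hc e he h3)

/-- The fraction of the complement of region `j` that is compatible with `i` on `S`. -/
def remaining (i : Fin m) (j : Fin k) (S : Finset (Fin n)) : ℝ :=
  ((I.compatible i S \ I.region j).card : ℝ) / ((I.region j)ᶜ.card : ℝ)

theorem one_sub_regionFun (i : Fin m) (j : Fin k) (S : Finset (Fin n)) :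
    1 - I.regionFun i j S = I.remaining i j S := by
  have hpos : (0 : ℝ) < ((I.region j)ᶜ.card : ℝ) := by exact_mod_cast I.card_compl_region_pos j
  have hsub : I.compatible i S \ I.region j ⊆ (I.region j)ᶜ := by
    intro x hx
    simpa using (Finset.mem_sdiff.1 hx).2
  unfold regionFun remaining
  rw [biUnion_differ, Finset.cast_card_sdiff hsub]
  field_simp
  ring

theorem remaining_nonneg (i : Fin m) (j : Fin k) (S : Finset (Fin n)) :
    0 ≤ I.remaining i j S := by
  unfold remaining
  positivity

theorem remaining_anti (i : Fin m) (j : Fin k) {S S' : Finset (Fin n)} (h : S ⊆ S') :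
    I.remaining i j S' ≤ I.remaining i j S := by
  unfold remaining
  have := Finset.card_le_card (Finset.sdiff_subset_sdiff (I.compatible_anti i h)
    (Finset.Subset.refl (I.region j)))
  gcongr

theorem remaining_empty (i : Fin m) (j : Fin k) : I.remaining i j ∅ = 1 := by
  have hpos : (0 : ℝ) < ((I.region j)ᶜ.card : ℝ) := by exact_mod_cast I.card_compl_region_pos j
  unfold remaining
  rw [compatible_empty, ← Finset.compl_eq_univ_sdiff, div_self hpos.ne']

theorem remaining_eq_zero {i : Fin m} {j : Fin k} {S : Finset (Fin n)} :
    I.remaining i j S = 0 ↔ I.compatible i S ⊆ I.region j := by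
  have hpos : (0 : ℝ) < ((I.region j)ᶜ.card : ℝ) := by exact_mod_cast I.card_compl_region_pos j
  unfold remaining
  rw [div_eq_zero_iff, or_iff_left hpos.ne', Nat.cast_eq_zero, Finset.card_eq_zero,
    Finset.sdiff_eq_empty_iff_subset]

/-- Compatible sets turn unions of test sets into intersections, and that of `S ∩ S'` contains both
others, so this is inclusion–exclusion for cardinalities. -/
theorem remaining_supermodular (i : Fin m) (j : Fin k) (S S' : Finset (Fin n)) :
    I.remaining i j S + I.remaining i j S' ≤
      I.remaining i j (S ∩ S') + I.remaining i j (S ∪ S') := by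
  unfold remaining
  rw [← add_div, ← add_div]
  refine div_le_div_of_nonneg_right ?_ (by positivity)
  norm_cast
  rw [← Finset.card_union_add_card_inter]
  refine add_le_add (Finset.card_le_card ?_) (Finset.card_le_card ?_)
  · rw [← Finset.union_sdiff_distrib]
    exact Finset.sdiff_subset_sdiff (Finset.union_subset
      (I.compatible_anti i Finset.inter_subset_left)
      (I.compatible_anti i Finset.inter_subset_right)) (Finset.Subset.refl _)
  · rw [compatible_union]
    intro x
    simp only [Finset.mem_inter, Finset.mem_sdiff]
    tauto

/-- The regions that contain `i`. -/
def regionsOf (i : Fin m) : Finset (Fin k) := Finset.univ.filter fun j => i ∈ I.region j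

theorem mem_regionsOf {i : Fin m} {j : Fin k} : j ∈ I.regionsOf i ↔ i ∈ I.region j := by
  simp [regionsOf]

theorem one_sub_orFun (i : Fin m) (S : Finset (Fin n)) :
    1 - I.orFun i S = ∏ j ∈ I.regionsOf i, I.remaining i j S := by
  simp only [orFun, one_sub_regionFun, sub_sub_cancel, regionsOf]

theorem orFun_eq (i : Fin m) (S : Finset (Fin n)) :
    I.orFun i S = 1 - ∏ j ∈ I.regionsOf i, I.remaining i j S := by
  rw [← one_sub_orFun, sub_sub_cancel]

/-- Here `a, b, c, d` stand for the values at the intersection, the two sets and the union. After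
lowering `a` to `b + c - d` and `a'` to `b' + c' - d'`, the excess is `(b - d)(c' - d') + (c - d)(b'
- d') ≥ 0`. -/
theorem mul_add_mul_le_of_supermodular {a b c d a' b' c' d' : ℝ} (hd : 0 ≤ d) (ha' : 0 ≤ a')
    (hdb : d ≤ b) (hdc : d ≤ c) (hdb' : d' ≤ b') (hdc' : d' ≤ c')
    (h : b + c ≤ a + d) (h' : b' + c' ≤ a' + d') :
    b * b' + c * c' ≤ a * a' + d * d' := by
  have h1 : (b + c - d) * a' ≤ a * a' := mul_le_mul_of_nonneg_right (by linarith) ha'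
  have h2 : (b + c - d) * (b' + c' - d') ≤ (b + c - d) * a' :=
    mul_le_mul_of_nonneg_left (by linarith) (by linarith)
  nlinarith [mul_nonneg (sub_nonneg.2 hdb) (sub_nonneg.2 hdc'),
    mul_nonneg (sub_nonneg.2 hdc) (sub_nonneg.2 hdb')]

theorem prod_remaining_anti (i : Fin m) (J : Finset (Fin k)) {S S' : Finset (Fin n)}
    (h : S ⊆ S') : ∏ j ∈ J, I.remaining i j S' ≤ ∏ j ∈ J, I.remaining i j S :=
  Finset.prod_le_prod (fun j _ => I.remaining_nonneg i j S') fun j _ => I.remaining_anti i j h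

theorem prod_remaining_nonneg (i : Fin m) (J : Finset (Fin k)) (S : Finset (Fin n)) :
    0 ≤ ∏ j ∈ J, I.remaining i j S :=
  Finset.prod_nonneg fun j _ => I.remaining_nonneg i j S

theorem prod_remaining_supermodular (i : Fin m) (J : Finset (Fin k)) (S S' : Finset (Fin n)) :
    ∏ j ∈ J, I.remaining i j S + ∏ j ∈ J, I.remaining i j S' ≤
      ∏ j ∈ J, I.remaining i j (S ∩ S') + ∏ j ∈ J, I.remaining i j (S ∪ S') := by
  induction J using Finset.induction_on with
  | empty => simp
  | insert j J hj ih =>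
    simp only [Finset.prod_insert hj]
    exact mul_add_mul_le_of_supermodular (I.remaining_nonneg i j _)
      (I.prod_remaining_nonneg i J _) (I.remaining_anti i j Finset.subset_union_left)
      (I.remaining_anti i j Finset.subset_union_right)
      (I.prod_remaining_anti i J Finset.subset_union_left)
      (I.prod_remaining_anti i J Finset.subset_union_right)
      (I.remaining_supermodular i j S S') ih

theorem orFun_mono (i : Fin m) {S S' : Finset (Fin n)} (h : S ⊆ S') :
    I.orFun i S ≤ I.orFun i S' := by
  rw [orFun_eq, orFun_eq]
  linarith [I.prod_remaining_anti i (I.regionsOf i) h]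

theorem orFun_submodular (i : Fin m) (S S' : Finset (Fin n)) :
    I.orFun i (S ∩ S') + I.orFun i (S ∪ S') ≤ I.orFun i S + I.orFun i S' := by
  simp only [orFun_eq]
  linarith [I.prod_remaining_supermodular i (I.regionsOf i) S S']

theorem orFun_empty (i : Fin m) : I.orFun i ∅ = 0 := by
  simp [orFun_eq, remaining_empty]

theorem orFun_eq_one_iff (i : Fin m) (S : Finset (Fin n)) :
    I.orFun i S = 1 ↔ ∃ j, i ∈ I.region j ∧ I.compatible i S ⊆ I.region j := by
  rw [orFun_eq, sub_eq_self, Finset.prod_eq_zero_iff]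
  simp only [mem_regionsOf, remaining_eq_zero]

theorem orFun_le_one (i : Fin m) (S : Finset (Fin n)) : I.orFun i S ≤ 1 := by
  rw [orFun_eq]
  linarith [I.prod_remaining_nonneg i (I.regionsOf i) S]

theorem orFun_nonneg (i : Fin m) (S : Finset (Fin n)) : 0 ≤ I.orFun i S := by
  rw [← I.orFun_empty i]
  exact I.orFun_mono i (Finset.empty_subset S)

theorem orFun_univ (i : Fin m) : I.orFun i Finset.univ = 1 := by
  rw [orFun_eq_one_iff]
  obtain ⟨j, hj⟩ := I.feasible i
  refine ⟨j, hj i fun e => Iff.rfl, fun h hh => hj h fun e => ?_⟩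
  rw [← outcome_eq_iff]
  exact I.mem_compatible.1 hh e (Finset.mem_univ e)

theorem isInstance_toASR : I.toASR.IsInstance where
  p_nonneg := I.p_nonneg
  p_sum := I.p_sum
  cost_pos := I.cost_pos
  f_mem i S := ⟨I.orFun_nonneg i S, I.orFun_le_one i S⟩
  f_empty := I.orFun_empty
  f_univ := I.orFun_univ
  f_mono i _ _ h := I.orFun_mono i h
  f_submod := I.orFun_submodular

theorem card_regionsOf_le (i : Fin m) : (I.regionsOf i).card ≤ I.maxOverlap :=
  Finset.le_sup (f := fun i : Fin m => (Finset.univ.filter fun j => i ∈ I.region j).card)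
    (Finset.mem_univ i)

theorem exists_mem_region (i : Fin m) : ∃ j, i ∈ I.region j := by
  obtain ⟨j, hj⟩ := I.feasible i
  exact ⟨j, hj i fun e => Iff.rfl⟩

/-- A single hypothesis would lie in a region, which would then be the whole set. The bound makes
`log m` positive. -/
theorem two_le_card (I : DRD m n k) : 2 ≤ m := by
  by_contra hm
  have hm : m = 0 ∨ m = 1 := by omega
  rcases hm with rfl | rfl
  · simpa using I.p_sum
  · obtain ⟨j, hj⟩ := I.exists_mem_region 0
    refine I.region_ne_univ j (Finset.eq_univ_of_forall fun i => ?_)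
    rwa [Subsingleton.elim i 0]

theorem one_le_maxOverlap : 1 ≤ I.maxOverlap := by
  have i : Fin m := ⟨0, by linarith [I.two_le_card]⟩
  obtain ⟨j, hj⟩ := I.exists_mem_region i
  exact (Finset.card_pos.2 ⟨j, I.mem_regionsOf.2 hj⟩).trans_le (I.card_regionsOf_le i)

theorem prod_card_compl_le (i : Fin m) :
    ∏ j ∈ I.regionsOf i, (I.region j)ᶜ.card ≤ m ^ I.maxOverlap := by
  calc ∏ j ∈ I.regionsOf i, (I.region j)ᶜ.card ≤ ∏ _j ∈ I.regionsOf i, m :=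
        Finset.prod_le_prod' fun j _ => (Finset.card_le_univ _).trans_eq (Fintype.card_fin m)
    _ = m ^ (I.regionsOf i).card := by rw [Finset.prod_const]
    _ ≤ m ^ I.maxOverlap :=
        Nat.pow_le_pow_right (by linarith [I.two_le_card]) (I.card_regionsOf_le i)

/-- Both values have the common denominator `∏ |D_jᶜ| ≤ m ^ r`, and their numerators are natural
numbers, so distinct numerators differ by at least one. -/
theorem inv_pow_le_orFun_sub {i : Fin m} {S S' : Finset (Fin n)}
    (h : I.orFun i S < I.orFun i S') :
    ((m : ℝ) ^ I.maxOverlap)⁻¹ ≤ I.orFun i S' - I.orFun i S := by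
  have hq : (0 : ℝ) < ∏ j ∈ I.regionsOf i, ((I.region j)ᶜ.card : ℝ) :=
    Finset.prod_pos fun j _ => by exact_mod_cast I.card_compl_region_pos j
  have hle : ∏ j ∈ I.regionsOf i, ((I.region j)ᶜ.card : ℝ) ≤ (m : ℝ) ^ I.maxOverlap := by
    exact_mod_cast I.prod_card_compl_le i
  simp only [orFun_eq, remaining, Finset.prod_div_distrib, sub_lt_sub_iff_left] at h ⊢
  rw [div_lt_div_iff_of_pos_right hq] at h
  rw [sub_sub_sub_cancel_left, ← sub_div]
  refine (inv_anti₀ hq hle).trans ?_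
  rw [inv_eq_one_div]
  refine div_le_div_of_nonneg_right ?_ hq.le
  rw [le_sub_iff_add_le, add_comm]
  exact_mod_cast Nat.succ_le_of_lt (by exact_mod_cast h)

theorem inv_pow_le_minIncrement : ((m : ℝ) ^ I.maxOverlap)⁻¹ ≤ I.toASR.minIncrement := by
  refine le_csInf ?_ ?_
  -- The infimum of the empty set would be `0`. Some increment is positive, for otherwise `f_i`
  -- could not rise from `0` at `∅` to `1`.
  · by_contra hne
    rw [Set.not_nonempty_iff_eq_empty, Set.eq_empty_iff_forall_notMem] at hne
    have i : Fin m := ⟨0, by linarith [I.two_le_card]⟩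
    have key : ∀ S : Finset (Fin n), I.orFun i S ≤ 0 := by
      intro S
      induction S using Finset.induction_on with
      | empty => exact (I.orFun_empty i).le
      | insert e S _ ih =>
        refine le_trans (not_lt.1 fun hlt => hne _ ⟨i, S, e, hlt, rfl⟩) ih
    linarith [key Finset.univ, I.orFun_univ i]
  · rintro x ⟨i, S, e, hlt, rfl⟩
    exact I.inv_pow_le_orFun_sub hlt

/-! ### Version spaces and feasibility of greedy policies -/

/-- `K` is the set of hypotheses compatible with the outcomes of the tests in `E`. -/
def IsVersionSpace (E : Finset (Fin n)) (K : Finset (Fin m)) : Prop :=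
  ∀ i ∈ K, I.compatible i E = K

theorem isVersionSpace_root : I.IsVersionSpace ∅ Finset.univ := fun i _ => I.compatible_empty i

theorem mem_yesPart {K : Finset (Fin m)} {e : Fin n} {i : Fin m} :
    i ∈ I.toASR.yesPart K e ↔ i ∈ K ∧ i ∈ I.test e := by
  simp [ASR.yesPart, toASR]

theorem mem_noPart {K : Finset (Fin m)} {e : Fin n} {i : Fin m} :
    i ∈ I.toASR.noPart K e ↔ i ∈ K ∧ i ∉ I.test e := by
  simp [ASR.noPart, toASR]

theorem mem_compatible_insert {i h : Fin m} {e : Fin n} {E : Finset (Fin n)} :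
    h ∈ I.compatible i (insert e E) ↔ (h ∈ I.test e ↔ i ∈ I.test e) ∧ h ∈ I.compatible i E := by
  simp [mem_compatible, outcome_eq_iff]

variable {I} {E : Finset (Fin n)} {K : Finset (Fin m)}

theorem IsVersionSpace.yesPart (hK : I.IsVersionSpace E K) (e : Fin n) :
    I.IsVersionSpace (insert e E) (I.toASR.yesPart K e) := by
  intro i hi
  rw [mem_yesPart] at hi
  ext h
  rw [mem_compatible_insert, hK i hi.1, mem_yesPart]
  tauto

theorem IsVersionSpace.noPart (hK : I.IsVersionSpace E K) (e : Fin n) :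
    I.IsVersionSpace (insert e E) (I.toASR.noPart K e) := by
  intro i hi
  rw [mem_noPart] at hi
  ext h
  rw [mem_compatible_insert, hK i hi.1, mem_noPart]
  tauto

/-- The right side does not depend on `i`: a version space is covered as a whole or not at all. -/
theorem IsVersionSpace.orFun_eq_one_iff (hK : I.IsVersionSpace E K) {i : Fin m} (hi : i ∈ K) :
    I.orFun i E = 1 ↔ ∃ j, K ⊆ I.region j := by
  rw [I.orFun_eq_one_iff, hK i hi]
  exact ⟨fun ⟨j, hj⟩ => ⟨j, hj.2⟩, fun ⟨j, hj⟩ => ⟨j, hj hi, hj⟩⟩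

theorem IsVersionSpace.uncovered_eq (hK : I.IsVersionSpace E K)
    (h : ¬ ∃ j, K ⊆ I.region j) : I.toASR.uncovered E K = K := by
  refine Finset.filter_true_of_mem fun i hi hc => h ?_
  exact (hK.orFun_eq_one_iff hi).1 hc

theorem IsVersionSpace.uncovered_eq_empty (hK : I.IsVersionSpace E K)
    (h : ∃ j, K ⊆ I.region j) : I.toASR.uncovered E K = ∅ := by
  refine Finset.filter_false_of_mem fun i hi hc => hc ?_
  exact (hK.orFun_eq_one_iff hi).2 h

theorem IsVersionSpace.not_covered (hK : I.IsVersionSpace E K)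
    (h : (I.toASR.uncovered E K).Nonempty) : ¬ ∃ j, K ⊆ I.region j := by
  intro hc
  rw [hK.uncovered_eq_empty hc] at h
  exact Finset.not_nonempty_empty h

theorem nonempty_of_not_covered (I : DRD m n k) {K : Finset (Fin m)}
    (h : ¬ ∃ j, K ⊆ I.region j) : K.Nonempty := by
  rw [Finset.nonempty_iff_ne_empty]
  rintro rfl
  have i : Fin m := ⟨0, by linarith [I.two_le_card]⟩
  obtain ⟨j, -⟩ := I.exists_mem_region i
  exact h ⟨j, Finset.empty_subset _⟩

theorem IsVersionSpace.orFun_lt_one (hK : I.IsVersionSpace E K)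
    (h : ¬ ∃ j, K ⊆ I.region j) {i : Fin m} (hi : i ∈ K) : I.orFun i E < 1 :=
  lt_of_le_of_ne (I.orFun_le_one i E) fun hc => h ((hK.orFun_eq_one_iff hi).1 hc)

theorem isFeasible_of_isGreedy {T : Policy n k} (hT : I.IsGreedy E K T) :
    ∀ i ∈ K, i ∈ I.region (T.decision (I.outcome i)) := by
  induction hT with
  | report E K j _ hj => exact fun i hi => hj hi
  | query E K e yes no _ _ _ _ ihy ihn =>
    intro i hi
    by_cases he : i ∈ I.test e
    · simpa [Policy.decision, outcome, he] using ihy i (I.mem_yesPart.2 ⟨hi, he⟩)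
    · simpa [Policy.decision, outcome, he] using ihn i (I.mem_noPart.2 ⟨hi, he⟩)

/-! ### The stem bound for an arbitrary feasible policy -/

variable (I)

/-- The cost of the policy under hypothesis `i`. -/
def costOf (T : Policy n k) (i : Fin m) : ℝ := ((T.path (I.outcome i)).map I.cost).sum

theorem costOf_report (j : Fin k) (i : Fin m) : I.costOf (Policy.report j) i = 0 := by
  simp [costOf, Policy.path]

theorem costOf_query_of_mem {e : Fin n} {yes no : Policy n k} {i : Fin m} (h : i ∈ I.test e) :
    I.costOf (Policy.query e yes no) i = I.cost e + I.costOf yes i := by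
  simp [costOf, Policy.path, outcome, h]

theorem costOf_query_of_notMem {e : Fin n} {yes no : Policy n k} {i : Fin m}
    (h : i ∉ I.test e) :
    I.costOf (Policy.query e yes no) i = I.cost e + I.costOf no i := by
  simp [costOf, Policy.path, outcome, h]

theorem costOf_nonneg (T : Policy n k) (i : Fin m) : 0 ≤ I.costOf T i := by
  refine List.sum_nonneg fun x hx => ?_
  obtain ⟨e, -, rfl⟩ := List.mem_map.1 hx
  exact (I.cost_pos e).le

theorem sum_yesPart_add_sum_noPart (K : Finset (Fin m)) (e : Fin n) (g : Fin m → ℝ) :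
    ∑ i ∈ I.toASR.yesPart K e, g i + ∑ i ∈ I.toASR.noPart K e, g i = ∑ i ∈ K, g i :=
  Finset.sum_filter_add_sum_filter_not K _ g

theorem card_yesPart_add_card_noPart (K : Finset (Fin m)) (e : Fin n) :
    (I.toASR.yesPart K e).card + (I.toASR.noPart K e).card = K.card :=
  Finset.card_filter_add_card_filter_not _

/-- The numerator of the greedy score: the weight of the small side plus the weighted relative
gains. -/
def gain (E : Finset (Fin n)) (K : Finset (Fin m)) (e : Fin n) (L : Finset (Fin m)) : ℝ :=
  ∑ j ∈ L, I.p j +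
    ∑ i ∈ K, I.p i * ((I.orFun i (insert e E) - I.orFun i E) / (1 - I.orFun i E))

theorem cost_mul_score (E : Finset (Fin n)) (K : Finset (Fin m)) (e : Fin n)
    (L : Finset (Fin m)) : I.cost e * I.toASR.score E K e L = I.gain E K e L := by
  have := (I.cost_pos e).ne'
  simp only [ASR.score, gain, toASR]
  field_simp

theorem relGain_nonneg (E : Finset (Fin n)) (e : Fin n) (i : Fin m) :
    0 ≤ (I.orFun i (insert e E) - I.orFun i E) / (1 - I.orFun i E) :=
  div_nonneg (sub_nonneg.2 (I.orFun_mono i (Finset.subset_insert e E)))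
    (sub_nonneg.2 (I.orFun_le_one i E))

theorem gain_nonneg (E : Finset (Fin n)) (K : Finset (Fin m)) (e : Fin n) (L : Finset (Fin m)) :
    0 ≤ I.gain E K e L :=
  add_nonneg (Finset.sum_nonneg fun i _ => I.p_nonneg i)
    (Finset.sum_nonneg fun i _ => mul_nonneg (I.p_nonneg i) (I.relGain_nonneg E e i))

variable {I}

/-- A performed test does not split the version space. -/
theorem IsVersionSpace.yesPart_or_noPart_eq_empty (hK : I.IsVersionSpace E K) {e : Fin n}
    (he : e ∈ E) : I.toASR.yesPart K e = ∅ ∨ I.toASR.noPart K e = ∅ := by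
  by_contra! hc
  obtain ⟨⟨i, hi⟩, ⟨h, hh⟩⟩ := hc
  rw [mem_yesPart] at hi
  rw [mem_noPart] at hh
  have h1 := hh.1
  rw [← hK i hi.1, mem_compatible] at h1
  exact hh.2 ((I.outcome_eq_iff.1 (h1 e he)).2 hi.2)

/-- For every test, performed or not, some side of the split has small weight in comparison with
the score of the greedy choice. -/
theorem IsVersionSpace.exists_minSide (hK : I.IsVersionSpace E K) {σ : ℝ} (hσ : 0 ≤ σ)
    {L : Fin n → Finset (Fin m)} (hL : ∀ e, e ∉ E → I.toASR.IsMinSide K e (L e))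
    (hmax : ∀ e, e ∉ E → I.toASR.score E K e (L e) ≤ σ) (e : Fin n) :
    I.gain E K e (I.toASR.yesPart K e) ≤ I.cost e * σ ∨
      I.gain E K e (I.toASR.noPart K e) ≤ I.cost e * σ := by
  by_cases he : e ∈ E
  -- The competitor may repeat tests of `E`. Such a test has an empty side and no relative gain, so
  -- its gain with that side is `0`.
  · have h0 : I.gain E K e ∅ ≤ I.cost e * σ := by
      simp only [gain, Finset.insert_eq_of_mem he, sub_self, zero_div, mul_zero,
        Finset.sum_const_zero, Finset.sum_empty, add_zero]
      exact mul_nonneg (I.cost_pos e).le hσ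
    rcases hK.yesPart_or_noPart_eq_empty he with h | h
    · exact .inl (h ▸ h0)
    · exact .inr (h ▸ h0)
  · have h1 := mul_le_mul_of_nonneg_left (hmax e he) (I.cost_pos e).le
    rw [cost_mul_score] at h1
    rcases hL e he with h | h
    · exact .inl (h.1 ▸ h1)
    · exact .inr (h.1 ▸ h1)

/-- The contribution of `i` to the stem bound: the part of its uncovered utility at `E` that is
left after the tests `S`, provided that the policy costs at most `t`. -/
def stemTerm (I : DRD m n k) (E S : Finset (Fin n)) (T : Policy n k) (t : ℝ) (i : Fin m) : ℝ :=
  if I.costOf T i ≤ t then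
    I.p i * ((1 - I.orFun i (E ∪ S)) / (1 - I.orFun i E)) else 0

theorem stemTerm_le_p (E S : Finset (Fin n)) (T : Policy n k) (t : ℝ) (i : Fin m) :
    I.stemTerm E S T t i ≤ I.p i := by
  unfold stemTerm
  split_ifs
  · refine mul_le_of_le_one_right (I.p_nonneg i) (div_le_one_of_le₀ ?_ ?_)
    · linarith [I.orFun_mono i (Finset.subset_union_left (s₁ := E) (s₂ := S))]
    · linarith [I.orFun_le_one i E]
  · exact I.p_nonneg i

/-- By submodularity `e` adds to `E ∪ S` at most what it adds to `E`, so the relative gain at `E`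
pays for the shrinking of the uncovered part. -/
theorem stemTerm_le {E S : Finset (Fin n)} {e : Fin n} {T T' : Policy n k} {t : ℝ} {i : Fin m}
    (hcost : I.costOf T i = I.cost e + I.costOf T' i) :
    I.stemTerm E S T t i ≤ I.stemTerm E (insert e S) T' (t - I.cost e) i +
      I.p i * ((I.orFun i (insert e E) - I.orFun i E) / (1 - I.orFun i E)) := by
  unfold stemTerm
  rw [hcost, if_congr (le_sub_iff_add_le'.symm) rfl rfl]
  split_ifs
  · rw [← mul_add, ← add_div]
    refine mul_le_mul_of_nonneg_left (div_le_div_of_nonneg_right ?_ ?_) (I.p_nonneg i)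
    · have h := I.orFun_submodular i (E ∪ S) (insert e E)
      have h1 := I.orFun_mono i (S := E) (S' := (E ∪ S) ∩ insert e E)
        (Finset.subset_inter Finset.subset_union_left (Finset.subset_insert e E))
      have h2 : (E ∪ S) ∪ insert e E = E ∪ insert e S := by
        ext x
        simp only [Finset.mem_union, Finset.mem_insert]
        tauto
      rw [h2] at h
      linarith
    · linarith [I.orFun_le_one i E]
  · rw [zero_add]
    exact mul_nonneg (I.p_nonneg i) (I.relGain_nonneg E e i)

/-- One test of the stem, which leaves the side `L` and follows the side `M`. Hypotheses outside `M`
are paid by the weight of `L`, those inside by their relative gains; together this is the gain, at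
most `c_e σ`. -/
theorem sum_stemTerm_query_le {S : Finset (Fin n)} {T T' : Policy n k} {e : Fin n} {t σ : ℝ}
    {A L M : Finset (Fin m)} (hA : A ⊆ K)
    (hcost : ∀ i ∈ M, I.costOf T i = I.cost e + I.costOf T' i) (hsplit : A ⊆ L ∪ M)
    (hgain : I.gain E K e L ≤ I.cost e * σ)
    (ih : ∑ i ∈ A ∩ M, I.stemTerm E (insert e S) T' (t - I.cost e) i ≤ (t - I.cost e) * σ) :
    ∑ i ∈ A, I.stemTerm E S T t i ≤ t * σ := by
  have h1 : ∑ i ∈ A \ M, I.stemTerm E S T t i ≤ ∑ i ∈ L, I.p i :=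
    (Finset.sum_le_sum fun i _ => stemTerm_le_p E S T t i).trans
      (Finset.sum_le_sum_of_subset_of_nonneg
        (fun i hi => by
          have := Finset.mem_sdiff.1 hi
          exact (Finset.mem_union.1 (hsplit this.1)).resolve_right this.2)
        fun i _ _ => I.p_nonneg i)
  have h2 : ∑ i ∈ A ∩ M, I.stemTerm E S T t i ≤
      ∑ i ∈ A ∩ M, I.stemTerm E (insert e S) T' (t - I.cost e) i +
        ∑ i ∈ K, I.p i * ((I.orFun i (insert e E) - I.orFun i E) / (1 - I.orFun i E)) := by
    refine (Finset.sum_le_sum fun i hi =>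
      stemTerm_le (hcost i (Finset.mem_inter.1 hi).2)).trans ?_
    rw [Finset.sum_add_distrib]
    refine add_le_add le_rfl (Finset.sum_le_sum_of_subset_of_nonneg
      (Finset.inter_subset_left.trans hA) fun i _ _ =>
        mul_nonneg (I.p_nonneg i) (I.relGain_nonneg E e i))
  rw [← Finset.sum_inter_add_sum_sdiff A M]
  unfold gain at hgain
  linarith

/-- Along the path of a feasible policy that leaves the small side at every test, the greedy
scores add up to the probability of the hypotheses that the policy decides at cost at most `t`. -/
theorem sum_stemTerm_le {σ : ℝ} (hσ : 0 ≤ σ)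
    (hmin : ∀ e, I.gain E K e (I.toASR.yesPart K e) ≤ I.cost e * σ ∨
      I.gain E K e (I.toASR.noPart K e) ≤ I.cost e * σ) (T : Policy n k) :
    ∀ (S : Finset (Fin n)) (A : Finset (Fin m)) (t : ℝ), A ⊆ K → 0 ≤ t →
      (∀ i ∈ A, ∀ h ∈ I.compatible i S, h ∈ I.region (T.decision (I.outcome h))) →
      ∑ i ∈ A, I.stemTerm E S T t i ≤ t * σ := by
  induction T with
  | report j =>
    intro S A t _ ht hfeas
    refine (Finset.sum_nonpos fun i hi => ?_).trans (mul_nonneg ht hσ)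
    -- At the leaf, the stem tests already force every compatible hypothesis into the reported
    -- region, so nothing of `i` remains uncovered.
    have h1 : I.orFun i (E ∪ S) = 1 := by
      rw [I.orFun_eq_one_iff]
      exact ⟨j, hfeas i hi i (I.self_mem_compatible i S), fun h hh => hfeas i hi h
        (I.compatible_anti i Finset.subset_union_right hh)⟩
    simp [stemTerm, h1]
  | query e yes no ihy ihn =>
    intro S A t hA ht hfeas
    rcases lt_or_ge t (I.cost e) with hte | hte
    -- The next test alone exceeds the remaining cost `t`, so every term is `0`.
    · refine (Finset.sum_nonpos fun i _ => ?_).trans (mul_nonneg ht hσ)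
      unfold stemTerm
      rw [if_neg]
      rw [not_le]
      by_cases hi : i ∈ I.test e
      · rw [I.costOf_query_of_mem hi]
        linarith [I.costOf_nonneg yes i]
      · rw [I.costOf_query_of_notMem hi]
        linarith [I.costOf_nonneg no i]
    · rcases hmin e with hg | hg
      · refine sum_stemTerm_query_le (M := I.toASR.noPart K e) hA
          (fun i hi => I.costOf_query_of_notMem (I.mem_noPart.1 hi).2) ?_ hg
          (ihn _ _ _ (Finset.inter_subset_left.trans hA) (sub_nonneg.2 hte) ?_)
        · intro i hi
          rw [Finset.mem_union, mem_yesPart, mem_noPart]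
          have := hA hi
          tauto
        · intro i hi h hh
          rw [mem_compatible_insert] at hh
          have hi := Finset.mem_inter.1 hi
          have h1 : h ∉ I.test e := fun hc => (I.mem_noPart.1 hi.2).2 (hh.1.1 hc)
          simpa [Policy.decision, outcome, h1] using hfeas i hi.1 h hh.2
      · refine sum_stemTerm_query_le (M := I.toASR.yesPart K e) hA
          (fun i hi => I.costOf_query_of_mem (I.mem_yesPart.1 hi).2) ?_ hg
          (ihy _ _ _ (Finset.inter_subset_left.trans hA) (sub_nonneg.2 hte) ?_)
        · intro i hi
          rw [Finset.mem_union, mem_yesPart, mem_noPart]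
          have := hA hi
          tauto
        · intro i hi h hh
          rw [mem_compatible_insert] at hh
          have hi := Finset.mem_inter.1 hi
          have h1 : h ∈ I.test e := hh.1.2 (I.mem_yesPart.1 hi.2).2
          simpa [Policy.decision, outcome, h1] using hfeas i hi.1 h hh.2

/-- A feasible policy decides hypotheses of total probability at most `t * σ` at cost at most `t`,
where `σ` is the score of the greedy choice. -/
theorem IsVersionSpace.sum_p_le (hK : I.IsVersionSpace E K) (hc : ¬ ∃ j, K ⊆ I.region j)
    {σ : ℝ} (hσ : 0 ≤ σ)
    (hmin : ∀ e, I.gain E K e (I.toASR.yesPart K e) ≤ I.cost e * σ ∨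
      I.gain E K e (I.toASR.noPart K e) ≤ I.cost e * σ) {T : Policy n k}
    (hT : I.IsFeasible T) {t : ℝ} (ht : 0 ≤ t) :
    ∑ i ∈ K with I.costOf T i ≤ t, I.p i ≤ t * σ := by
  refine le_trans (le_of_eq ?_)
    (sum_stemTerm_le hσ hmin T ∅ K t (Finset.Subset.refl K) ht fun i _ h _ => hT h)
  rw [Finset.sum_filter]
  refine Finset.sum_congr rfl fun i hi => ?_
  -- At the start of the stem `S = ∅`, so the ratio in `stemTerm` is `1`.
  have : 1 - I.orFun i E ≠ 0 := (sub_pos.2 (hK.orFun_lt_one hc hi)).ne'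
  rw [stemTerm, Finset.union_empty, div_self this, mul_one]

/-! ### The potential that pays for greedy gains -/

variable (I)

/-- A bound on the relative gains that `i` can still contribute after the tests `E`. -/
def gainBudget (i : Fin m) (E : Finset (Fin n)) : ℝ :=
  if I.orFun i E = 1 then 0
  else 1 + Real.log ((1 - I.orFun i E) * (m : ℝ) ^ I.maxOverlap)

/-- The rise from `f_i(E)` to `f_i(U) = 1` is a positive increment, hence at least `m ^ (-r)`. This
keeps the logarithm in `gainBudget` nonnegative. -/
theorem one_le_mul_pow {i : Fin m} {E : Finset (Fin n)} (h : I.orFun i E ≠ 1) :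
    1 ≤ (1 - I.orFun i E) * (m : ℝ) ^ I.maxOverlap := by
  have hm : (0 : ℝ) < (m : ℝ) ^ I.maxOverlap := by
    have := I.two_le_card
    positivity
  have h1 := I.inv_pow_le_orFun_sub (i := i) (S := E) (S' := Finset.univ)
    (by rw [I.orFun_univ]; exact lt_of_le_of_ne (I.orFun_le_one i E) h)
  rw [I.orFun_univ] at h1
  exact (inv_le_iff_one_le_mul₀ hm).1 h1

theorem gainBudget_nonneg (i : Fin m) (E : Finset (Fin n)) : 0 ≤ I.gainBudget i E := by
  unfold gainBudget
  split_ifs with h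
  · exact le_rfl
  · linarith [Real.log_nonneg (I.one_le_mul_pow h)]

theorem gainBudget_le (i : Fin m) (E : Finset (Fin n)) :
    I.gainBudget i E ≤ 1 + I.maxOverlap * Real.log m := by
  have h2 : (2 : ℝ) ≤ m := by exact_mod_cast I.two_le_card
  unfold gainBudget
  split_ifs with h
  · have := Real.log_nonneg (by linarith : (1 : ℝ) ≤ m)
    positivity
  · rw [← Real.log_pow]
    have hpos := I.one_le_mul_pow h
    refine add_le_add le_rfl (Real.log_le_log (by linarith) ?_)
    exact mul_le_of_le_one_left (by positivity) (by linarith [I.orFun_nonneg i E])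

/-- With `x` the ratio of the new to the old uncovered part, this is `1 - x ≤ -log x`. When `e`
covers `i` and `x = 0`, the relative gain is `1` and is paid by the summand `1` of the budget. -/
theorem relGain_le_gainBudget_sub {i : Fin m} {E : Finset (Fin n)} (e : Fin n)
    (h : I.orFun i E ≠ 1) :
    (I.orFun i (insert e E) - I.orFun i E) / (1 - I.orFun i E) ≤
      I.gainBudget i E - I.gainBudget i (insert e E) := by
  have hm : (0 : ℝ) < (m : ℝ) ^ I.maxOverlap := by
    have := I.two_le_card
    positivity
  have hpos : 0 < 1 - I.orFun i E := sub_pos.2 (lt_of_le_of_ne (I.orFun_le_one i E) h)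
  by_cases h' : I.orFun i (insert e E) = 1
  · rw [h', div_self hpos.ne', gainBudget, gainBudget, if_neg h, if_pos h']
    linarith [Real.log_nonneg (I.one_le_mul_pow h)]
  · have hpos' : 0 < 1 - I.orFun i (insert e E) :=
      sub_pos.2 (lt_of_le_of_ne (I.orFun_le_one i _) h')
    rw [gainBudget, gainBudget, if_neg h, if_neg h', Real.log_mul hpos.ne' hm.ne',
      Real.log_mul hpos'.ne' hm.ne']
    have h1 := Real.log_le_sub_one_of_pos (div_pos hpos' hpos)
    rw [Real.log_div hpos'.ne' hpos.ne'] at h1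
    have h2 : (I.orFun i (insert e E) - I.orFun i E) / (1 - I.orFun i E) =
        1 - (1 - I.orFun i (insert e E)) / (1 - I.orFun i E) := by
      field_simp
      ring
    linarith

/-- The potential of a state of the greedy algorithm. -/
def potential (E : Finset (Fin n)) (K : Finset (Fin m)) : ℝ :=
  ∑ i ∈ K, I.p i * (Real.logb 2 K.card + I.gainBudget i E)

theorem sum_p_mul_logb_le {L K : Finset (Fin m)} (h : L ⊆ K) :
    ∑ i ∈ L, I.p i * Real.logb 2 L.card ≤ ∑ i ∈ L, I.p i * Real.logb 2 K.card := by
  refine Finset.sum_le_sum fun i hi => mul_le_mul_of_nonneg_left ?_ (I.p_nonneg i)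
  have h0 : 0 < L.card := Finset.card_pos.2 ⟨i, hi⟩
  exact Real.logb_le_logb_of_le one_lt_two (by exact_mod_cast h0)
    (by exact_mod_cast Finset.card_le_card h)

/-- Halving the cardinality lowers the binary logarithm by one, so the smaller side of a split pays
for its own probability. -/
theorem sum_p_mul_logb_add_le {L K : Finset (Fin m)} (h : 2 * L.card ≤ K.card) :
    ∑ i ∈ L, I.p i * Real.logb 2 L.card + ∑ i ∈ L, I.p i ≤
      ∑ i ∈ L, I.p i * Real.logb 2 K.card := by
  rw [← Finset.sum_add_distrib]
  refine Finset.sum_le_sum fun i hi => ?_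
  rw [← mul_add_one]
  refine mul_le_mul_of_nonneg_left ?_ (I.p_nonneg i)
  have h0 : (0 : ℝ) < L.card := by exact_mod_cast Finset.card_pos.2 ⟨i, hi⟩
  have h1 : Real.logb 2 L.card + 1 = Real.logb 2 (2 * L.card) := by
    rw [Real.logb_mul two_ne_zero h0.ne', Real.logb_self_eq_one one_lt_two, add_comm]
  rw [h1]
  exact Real.logb_le_logb_of_le one_lt_two (by positivity) (by exact_mod_cast h)

theorem yesPart_subset (K : Finset (Fin m)) (e : Fin n) : I.toASR.yesPart K e ⊆ K :=
  Finset.filter_subset _ _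

theorem noPart_subset (K : Finset (Fin m)) (e : Fin n) : I.toASR.noPart K e ⊆ K :=
  Finset.filter_subset _ _

variable {I}

/-- The weighted gains of a greedy choice are paid by the decrease of the potential. -/
theorem IsVersionSpace.gain_add_potential_le (hK : I.IsVersionSpace E K)
    (hc : ¬ ∃ j, K ⊆ I.region j) {e : Fin n} {L : Finset (Fin m)}
    (hL : I.toASR.IsMinSide K e L) :
    I.gain E K e L + (I.potential (insert e E) (I.toASR.yesPart K e) +
      I.potential (insert e E) (I.toASR.noPart K e)) ≤ I.potential E K := by
  have hsplit := I.sum_yesPart_add_sum_noPart K e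
  have hcard := I.card_yesPart_add_card_noPart K e
  have h1 : ∑ i ∈ K, I.p i * ((I.orFun i (insert e E) - I.orFun i E) / (1 - I.orFun i E)) ≤
      ∑ i ∈ K, I.p i * I.gainBudget i E - ∑ i ∈ K, I.p i * I.gainBudget i (insert e E) := by
    rw [← Finset.sum_sub_distrib]
    refine Finset.sum_le_sum fun i hi => ?_
    rw [← mul_sub]
    exact mul_le_mul_of_nonneg_left
      (I.relGain_le_gainBudget_sub e (hK.orFun_lt_one hc hi).ne) (I.p_nonneg i)
  have h2 : ∑ i ∈ L, I.p i +
      (∑ i ∈ I.toASR.yesPart K e, I.p i * Real.logb 2 (I.toASR.yesPart K e).card +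
        ∑ i ∈ I.toASR.noPart K e, I.p i * Real.logb 2 (I.toASR.noPart K e).card) ≤
      ∑ i ∈ K, I.p i * Real.logb 2 K.card := by
    rw [← hsplit fun i => I.p i * Real.logb 2 K.card]
    rcases hL with ⟨rfl, hle⟩ | ⟨rfl, hle⟩
    · linarith [I.sum_p_mul_logb_add_le (L := I.toASR.yesPart K e) (K := K) (by omega),
        I.sum_p_mul_logb_le (I.noPart_subset K e)]
    · linarith [I.sum_p_mul_logb_add_le (L := I.toASR.noPart K e) (K := K) (by omega),
        I.sum_p_mul_logb_le (I.yesPart_subset K e)]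
  have h3 := hsplit fun i => I.p i * I.gainBudget i (insert e E)
  simp only [potential, gain, mul_add, Finset.sum_add_distrib]
  linarith

theorem potential_le (I : DRD m n k) (E : Finset (Fin n)) (K : Finset (Fin m)) :
    I.potential E K ≤
      (∑ i ∈ K, I.p i) * (Real.logb 2 m + (1 + I.maxOverlap * Real.log m)) := by
  rw [potential, Finset.sum_mul]
  refine Finset.sum_le_sum fun i hi => mul_le_mul_of_nonneg_left
    (add_le_add ?_ (I.gainBudget_le i E)) (I.p_nonneg i)
  have h0 : 0 < K.card := Finset.card_pos.2 ⟨i, hi⟩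
  exact Real.logb_le_logb_of_le one_lt_two (by exact_mod_cast h0)
    (by exact_mod_cast (Finset.card_le_univ K).trans_eq (Fintype.card_fin m))

theorem potential_nonneg (I : DRD m n k) (E : Finset (Fin n)) (K : Finset (Fin m)) :
    0 ≤ I.potential E K := by
  refine Finset.sum_nonneg fun i hi => mul_nonneg (I.p_nonneg i)
    (add_nonneg (Real.logb_nonneg one_lt_two ?_) (I.gainBudget_nonneg i E))
  exact_mod_cast Nat.one_le_iff_ne_zero.2 (Finset.card_pos.2 ⟨i, hi⟩).ne'

/-! ### Charging the greedy cost to the competitor -/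

theorem sum_costOf_query (I : DRD m n k) (K : Finset (Fin m)) (e : Fin n)
    (yes no : Policy n k) :
    ∑ i ∈ K, I.p i * I.costOf (Policy.query e yes no) i =
      I.cost e * ∑ i ∈ K, I.p i + (∑ i ∈ I.toASR.yesPart K e, I.p i * I.costOf yes i +
        ∑ i ∈ I.toASR.noPart K e, I.p i * I.costOf no i) := by
  rw [← I.sum_yesPart_add_sum_noPart K e, ← I.sum_yesPart_add_sum_noPart K e I.p, mul_add,
    Finset.mul_sum, Finset.mul_sum, add_add_add_comm, ← Finset.sum_add_distrib,
    ← Finset.sum_add_distrib]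
  congr 1
  · refine Finset.sum_congr rfl fun i hi => ?_
    rw [I.costOf_query_of_mem (I.mem_yesPart.1 hi).2]
    ring
  · refine Finset.sum_congr rfl fun i hi => ?_
    rw [I.costOf_query_of_notMem (I.mem_noPart.1 hi).2]
    ring

/-- If at most half of `K` is decided below the cost `P / 2`, then raising the truncation level
from `M / 2` to `P / 2` raises the truncated cost on `K` accordingly. -/
theorem sub_mul_sum_le_truncated (I : DRD m n k) {K : Finset (Fin m)} {T : Policy n k}
    {M P : ℝ} (hMP : M ≤ P)
    (h : 2 * ∑ i ∈ K with I.costOf T i ≤ P / 2, I.p i ≤ ∑ i ∈ K, I.p i) :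
    (P - M) * ∑ i ∈ K, I.p i ≤
      4 * ∑ i ∈ K, I.p i * (min (I.costOf T i) (P / 2) - min (I.costOf T i) (M / 2)) := by
  have h1 := Finset.sum_filter_add_sum_filter_not K (fun i => I.costOf T i ≤ P / 2) I.p
  -- Each hypothesis above `P / 2` contributes `(P - M) / 2`, and these have at least half of the
  -- mass; hence the factor `4`.
  have h2 : ∑ i ∈ K with ¬ I.costOf T i ≤ P / 2, I.p i * ((P - M) / 2) ≤
      ∑ i ∈ K, I.p i * (min (I.costOf T i) (P / 2) - min (I.costOf T i) (M / 2)) := by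
    have hnn : ∀ i, 0 ≤ I.p i * (min (I.costOf T i) (P / 2) - min (I.costOf T i) (M / 2)) :=
      fun i => mul_nonneg (I.p_nonneg i) (sub_nonneg.2 (min_le_min le_rfl (by linarith)))
    refine le_trans (Finset.sum_le_sum fun i hi => ?_)
      (Finset.sum_le_sum_of_subset_of_nonneg (Finset.filter_subset _ K) fun i _ _ => hnn i)
    have hi := not_le.1 (Finset.mem_filter.1 hi).2
    refine mul_le_mul_of_nonneg_left ?_ (I.p_nonneg i)
    rw [min_eq_right hi.le, min_eq_right (by linarith)]
    linarith
  rw [← Finset.sum_mul] at h2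
  nlinarith [mul_nonneg (sub_nonneg.2 hMP) (sub_nonneg.2 h)]

/-- The greedy policy against an arbitrary feasible policy `T'`. The expected cost of the subtree
is charged to the potential at price `M` per unit, and to the cost of `T'` above `M / 2`. -/
theorem sum_costOf_le {T T' : Policy n k} (hT' : I.IsFeasible T') {Λ : ℝ}
    (hΛ : ∀ (E : Finset (Fin n)) (K : Finset (Fin m)), I.potential E K ≤ (∑ i ∈ K, I.p i) * Λ)
    (hΛ0 : 0 ≤ Λ) (hT : I.IsGreedy E K T) :
    I.IsVersionSpace E K → ∀ M : ℝ, 0 ≤ M →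
      ∑ i ∈ K, I.p i * I.costOf T i ≤ M * I.potential E K +
        4 * Λ * ∑ i ∈ K, I.p i * (I.costOf T' i - min (I.costOf T' i) (M / 2)) := by
  induction hT with
  | report E K j _ _ =>
    intro _ M hM
    simp only [costOf_report, mul_zero, Finset.sum_const_zero]
    refine add_nonneg (mul_nonneg hM (I.potential_nonneg E K))
      (mul_nonneg (by linarith) (Finset.sum_nonneg fun i _ => mul_nonneg (I.p_nonneg i) ?_))
    exact sub_nonneg.2 (min_le_left _ _)
  | query E K e yes no hunc he _ _ ihy ihn =>
    intro hK M hM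
    have hc := hK.not_covered hunc
    rw [hK.uncovered_eq hc] at he
    obtain ⟨heE, L, hL, hmax⟩ := he
    have hgain := hK.gain_add_potential_le hc (hL e heE)
    set W := I.gain E K e (L e) with hW
    set σ := I.toASR.score E K e (L e) with hσdef
    have hWσ : I.cost e * σ = W := I.cost_mul_score E K e (L e)
    have hce := I.cost_pos e
    have hW0 : 0 ≤ W := I.gain_nonneg E K e (L e)
    have hσ : 0 ≤ σ := by
      by_contra hneg
      nlinarith [mul_neg_of_pos_of_neg hce (not_le.1 hneg)]
    have hstem : ∀ t, 0 ≤ t → ∑ i ∈ K with I.costOf T' i ≤ t, I.p i ≤ t * σ := fun t ht =>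
      hK.sum_p_le hc hσ (hK.exists_minSide hσ hL hmax) hT' ht
    have hp0 : 0 ≤ ∑ i ∈ K, I.p i := Finset.sum_nonneg fun i _ => I.p_nonneg i
    -- `P` is the price of one unit of gain at this node. If `σ = 0`, the stem bound with a `t`
    -- exceeding all costs on `K` gives `p(K) = 0`, and `P = 0` works.
    obtain ⟨P, hP0, hPW⟩ : ∃ P, 0 ≤ P ∧ P * σ = ∑ i ∈ K, I.p i := by
      rcases hσ.eq_or_lt with h0 | h0
      · refine ⟨0, le_rfl, ?_⟩
        have hall := hstem (∑ i ∈ K, I.costOf T' i)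
          (Finset.sum_nonneg fun i _ => I.costOf_nonneg T' i)
        rw [Finset.filter_true_of_mem fun i hi => Finset.single_le_sum
          (fun i _ => I.costOf_nonneg T' i) hi] at hall
        rw [← h0, mul_zero] at *
        exact le_antisymm hp0 hall
      · exact ⟨(∑ i ∈ K, I.p i) / σ, div_nonneg hp0 h0.le, div_mul_cancel₀ _ h0.ne'⟩
    have hhalf : 2 * ∑ i ∈ K with I.costOf T' i ≤ P / 2, I.p i ≤ ∑ i ∈ K, I.p i := by
      linarith [hstem (P / 2) (by linarith)]
    have hy := ihy (hK.yesPart e) (max M P) (le_max_of_le_left hM)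
    have hn := ihn (hK.noPart e) (max M P) (le_max_of_le_left hM)
    have hsplit := I.sum_yesPart_add_sum_noPart K e
      fun i => I.p i * (I.costOf T' i - min (I.costOf T' i) (max M P / 2))
    have hstep : ∑ i ∈ K, I.p i * I.costOf (Policy.query e yes no) i ≤
        max M P * I.potential E K + 4 * Λ *
          ∑ i ∈ K, I.p i * (I.costOf T' i - min (I.costOf T' i) (max M P / 2)) := by
      rw [I.sum_costOf_query, ← hPW, ← hsplit]
      -- The cost of this node is `c_e P σ = P W`, and at price `max M P` the drop of the potential
      -- covers it.
      have h1 : I.cost e * (P * σ) ≤ max M P * W := by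
        rw [← hWσ, mul_left_comm]
        exact mul_le_mul_of_nonneg_right (le_max_right M P) (hWσ ▸ hW0)
      have h2 := mul_le_mul_of_nonneg_left hgain (hM.trans (le_max_left M P))
      linarith
    rcases le_total P M with hPM | hPM
    · rwa [max_eq_left hPM] at hstep
    · rw [max_eq_right hPM] at hstep
      refine hstep.trans ?_
      -- The price rises from `M` to `P`. The extra `(P - M)` times the potential is at most `(P -
      -- M) p(K) Λ`, which the slice of the competitor's cost between `M / 2` and `P / 2` pays.
      have h1 := mul_le_mul_of_nonneg_left (I.sub_mul_sum_le_truncated hPM hhalf) hΛ0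
      have h2 := mul_le_mul_of_nonneg_left (hΛ E K) (sub_nonneg.2 hPM)
      simp only [mul_sub, Finset.sum_sub_distrib] at h1 ⊢
      linarith

variable (I) in
theorem expectedCost_eq (T : Policy n k) : I.expectedCost T = ∑ i, I.p i * I.costOf T i := rfl

/-- At the root the price is `0`, so the whole charge is `4 Λ` times the competitor's cost. Since `r
≥ 1` and `m ≥ 2`, both `log₂ m` and `1` are at most `r log m / log 2`, which yields the constant. -/
theorem expectedCost_le_of_isGreedyPolicy {T T' : Policy n k} (hT : I.IsGreedyPolicy T)
    (hT' : I.IsFeasible T') :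
    I.expectedCost T ≤
      4 * (1 + 2 / Real.log 2) * (I.maxOverlap * Real.log m) * I.expectedCost T' := by
  have h2 : (2 : ℝ) ≤ m := by exact_mod_cast I.two_le_card
  have hr : (1 : ℝ) ≤ I.maxOverlap := by exact_mod_cast I.one_le_maxOverlap
  have hlog2 := Real.log_pos one_lt_two
  have hlog : Real.log 2 ≤ Real.log m := Real.log_le_log two_pos h2
  set Λ := Real.logb 2 m + (1 + I.maxOverlap * Real.log m) with hΛ
  have hΛ0 : 0 ≤ Λ := by
    have := Real.logb_nonneg one_lt_two (by linarith : (1 : ℝ) ≤ m)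
    have : 0 ≤ Real.log m := by linarith
    positivity
  have hΛle : Λ ≤ (1 + 2 / Real.log 2) * (I.maxOverlap * Real.log m) := by
    have h3 : Real.log m / Real.log 2 ≤ I.maxOverlap * Real.log m / Real.log 2 :=
      div_le_div_of_nonneg_right (le_mul_of_one_le_left (by linarith) hr) hlog2.le
    have h4 : 1 ≤ I.maxOverlap * Real.log m / Real.log 2 :=
      le_trans ((one_le_div hlog2).2 hlog) h3
    have h5 : (1 + 2 / Real.log 2) * (I.maxOverlap * Real.log m) =
        I.maxOverlap * Real.log m + 2 * (I.maxOverlap * Real.log m / Real.log 2) := by ring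
    rw [h5, hΛ, Real.logb]
    linarith
  have hmain := sum_costOf_le hT' I.potential_le hΛ0 hT I.isVersionSpace_root 0 le_rfl
  have hmin : ∀ i, min (I.costOf T' i) (0 / 2) = 0 := fun i => by
    rw [zero_div]
    exact min_eq_right (I.costOf_nonneg T' i)
  simp only [hmin, sub_zero, zero_mul, zero_add, ← expectedCost_eq] at hmain
  have hnn : 0 ≤ I.expectedCost T' :=
    Finset.sum_nonneg fun i _ => mul_nonneg (I.p_nonneg i) (I.costOf_nonneg T' i)
  rw [mul_assoc 4]
  exact hmain.trans (mul_le_mul_of_nonneg_right (by linarith) hnn)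

end DRD

/-! ### Frame properties and loop rule of the machine -/

namespace RealRAM

namespace Program

/-- The arrays of natural numbers that a program may write. -/
def natArrays : Program → List ℕ
  | skip => []
  | setNat a _ _ _ => [a]
  | setReal _ _ _ _ => []
  | seq P Q => P.natArrays ++ Q.natArrays
  | cond _ P Q => P.natArrays ++ Q.natArrays
  | loop a _ body => a :: body.natArrays
  | perform a _ => [a]

/-- The arrays of real numbers that a program may write. -/
def realArrays : Program → List ℕ
  | skip => []
  | setNat _ _ _ _ => []
  | setReal a _ _ _ => [a]
  | seq P Q => P.realArrays ++ Q.realArrays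
  | cond _ P Q => P.realArrays ++ Q.realArrays
  | loop _ _ body => body.realArrays
  | perform _ _ => []

/-- The program contains no `perform` instruction. -/
def performFree : Program → Bool
  | skip => true
  | setNat _ _ _ _ => true
  | setReal _ _ _ _ => true
  | seq P Q => P.performFree && Q.performFree
  | cond _ P Q => P.performFree && Q.performFree
  | loop _ _ body => body.performFree
  | perform _ _ => false

end Program

/-- A relation between states that holds along `foldl` if it holds for every step. -/
theorem foldl_rel {α β : Type*} (r : β → β → Prop) (hrefl : ∀ s, r s s)
    (htrans : ∀ s t u, r s t → r t u → r s u) (f : β → α → β) (hf : ∀ s x, r s (f s x))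
    (l : List α) (s : β) : r s (l.foldl f s) := by
  induction l generalizing s with
  | nil => exact hrefl s
  | cons x l ih => exact htrans _ _ _ (hf s x) (ih _)

variable {ans ans' : ℕ → Bool}

/-- Frame rule: the written arrays are a syntactic list, so for concrete programs the side condition
is settled by `decide`. -/
theorem Program.exec_nat (P : Program) {a : ℕ} (ha : a ∉ P.natArrays) (s : State) :
    (P.exec ans s).nat a = s.nat a := by
  induction P generalizing s with
  | skip => rfl
  | setNat b i j x =>
    funext x y
    have : a ≠ b := by simpa [natArrays] using ha
    simp [exec, State.writeNat, State.tick, this]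
  | setReal b i j x => rfl
  | seq P Q ihP ihQ =>
    simp only [natArrays, List.mem_append, not_or] at ha
    rw [exec, ihQ ha.2, ihP ha.1]
    rfl
  | cond b P Q ihP ihQ =>
    simp only [natArrays, List.mem_append, not_or] at ha
    rw [exec]
    split_ifs
    · rw [ihP ha.1]; rfl
    · rw [ihQ ha.2]; rfl
  | loop b x body ih =>
    simp only [natArrays, List.mem_cons, not_or] at ha
    rw [exec]
    refine (foldl_rel (fun s t : State => t.nat a = s.nat a) (fun _ => rfl)
      (fun s t u h1 h2 => h2.trans h1) _ (fun s t => ?_) _ _).trans rfl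
    rw [ih ha.2]
    funext x y
    simp [State.writeNat, State.tick, ha.1]
  | perform b x =>
    funext x y
    have : a ≠ b := by simpa [natArrays] using ha
    simp [exec, State.writeNat, State.tick, this]

theorem Program.exec_real (P : Program) {a : ℕ} (ha : a ∉ P.realArrays) (s : State) :
    (P.exec ans s).real a = s.real a := by
  induction P generalizing s with
  | skip => rfl
  | setNat b i j x => rfl
  | setReal b i j x =>
    funext x y
    have : a ≠ b := by simpa [realArrays] using ha
    simp [exec, State.writeReal, State.tick, this]
  | seq P Q ihP ihQ =>
    simp only [realArrays, List.mem_append, not_or] at ha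
    rw [exec, ihQ ha.2, ihP ha.1]
    rfl
  | cond b P Q ihP ihQ =>
    simp only [realArrays, List.mem_append, not_or] at ha
    rw [exec]
    split_ifs
    · rw [ihP ha.1]; rfl
    · rw [ihQ ha.2]; rfl
  | loop b x body ih =>
    rw [exec]
    refine (foldl_rel (fun s t : State => t.real a = s.real a) (fun _ => rfl)
      (fun s t u h1 h2 => h2.trans h1) _ (fun s t => ?_) _ _).trans rfl
    rw [ih ha]
    rfl
  | perform b x => rfl

theorem Program.exec_log (P : Program) (hP : P.performFree = true) (s : State) :
    (P.exec ans s).log = s.log := by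
  induction P generalizing s with
  | skip => rfl
  | setNat b i j x => rfl
  | setReal b i j x => rfl
  | seq P Q ihP ihQ =>
    simp only [performFree, Bool.and_eq_true] at hP
    rw [exec, ihQ hP.2, ihP hP.1]
    rfl
  | cond b P Q ihP ihQ =>
    simp only [performFree, Bool.and_eq_true] at hP
    rw [exec]
    split_ifs
    · rw [ihP hP.1]; rfl
    · rw [ihQ hP.2]; rfl
  | loop b x body ih =>
    rw [exec]
    refine (foldl_rel (fun s t : State => t.log = s.log) (fun _ => rfl)
      (fun s t u h1 h2 => h2.trans h1) _ (fun s t => ?_) _ _).trans rfl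
    rw [ih hP]
    rfl
  | perform b x => simp [performFree] at hP

/-- Answers enter only through `perform`. Hence the computation that selects a test is the same
under every hypothesis, which is what makes the run a decision tree. -/
theorem Program.exec_congr (P : Program) (hP : P.performFree = true) (s : State) :
    P.exec ans s = P.exec ans' s := by
  induction P generalizing s with
  | skip => rfl
  | setNat b i j x => rfl
  | setReal b i j x => rfl
  | seq P Q ihP ihQ =>
    simp only [performFree, Bool.and_eq_true] at hP
    rw [exec, exec, ihQ hP.2, ihP hP.1]
  | cond b P Q ihP ihQ =>
    simp only [performFree, Bool.and_eq_true] at hP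
    rw [exec, exec, ihP hP.1, ihQ hP.2]
  | loop b x body ih =>
    rw [exec, exec]
    congr 1
    funext s t
    exact ih hP _
  | perform b x => simp [performFree] at hP

theorem NatExpr.eval_tick (x : NatExpr) (s : State) (t : ℕ) : x.eval (s.tick t) = x.eval s := by
  induction x with
  | const c => rfl
  | read a i j hi hj => rw [eval, eval, hi, hj]; rfl
  | add x y hx hy => rw [eval, eval, hx, hy]
  | sub x y hx hy => rw [eval, eval, hx, hy]

theorem RealExpr.eval_tick (x : RealExpr) (s : State) (t : ℕ) :
    x.eval (s.tick t) = x.eval s := by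
  induction x with
  | const c => rfl
  | read a i j => rw [eval, eval, NatExpr.eval_tick, NatExpr.eval_tick]; rfl
  | add x y hx hy => rw [eval, eval, hx, hy]
  | sub x y hx hy => rw [eval, eval, hx, hy]
  | mul x y hx hy => rw [eval, eval, hx, hy]
  | div x y hx hy => rw [eval, eval, hx, hy]

theorem Cond.holds_tick (b : Cond) (s : State) (t : ℕ) : b.Holds (s.tick t) ↔ b.Holds s := by
  cases b <;> simp only [Holds, NatExpr.eval_tick, RealExpr.eval_tick]

theorem State.tick_comm (s : State) (t d : ℕ) : (s.tick t).tick d = (s.tick d).tick t := by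
  simp only [tick, Nat.add_right_comm]

/-- No expression reads the step counter, so ticks can be moved to the end and ignored when
reasoning about memory. -/
theorem Program.exec_tick (P : Program) (s : State) (t : ℕ) :
    P.exec ans (s.tick t) = (P.exec ans s).tick t := by
  induction P generalizing s with
  | skip => exact s.tick_comm t 1
  | setNat b i j x =>
    rw [exec, exec, NatExpr.eval_tick, NatExpr.eval_tick, NatExpr.eval_tick, State.tick_comm]
    rfl
  | setReal b i j x =>
    rw [exec, exec, NatExpr.eval_tick, NatExpr.eval_tick, RealExpr.eval_tick, State.tick_comm]
    rfl
  | seq P Q ihP ihQ => rw [exec, exec, State.tick_comm, ihP, ihQ]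
  | cond b P Q ihP ihQ =>
    rw [exec, exec, State.tick_comm, ihP, ihQ, apply_ite (fun u : State => u.tick t)]
    by_cases h : b.Holds s
    · rw [if_pos h, if_pos ((b.holds_tick s t).2 h)]
    · rw [if_neg h, if_neg (mt (b.holds_tick s t).1 h)]
  | loop b x body ih =>
    rw [exec, exec, NatExpr.eval_tick, State.tick_comm]
    generalize s.tick (x.time + 1) = u
    generalize List.range (x.eval s) = l
    induction l generalizing u with
    | nil => rfl
    | cons d l ihl =>
      rw [List.foldl_cons, List.foldl_cons, ← ihl, ← ih]
      congr 1
      exact congrArg (body.exec ans) (State.tick_comm (u.writeNat b 0 0 d) t 1)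
  | perform b x =>
    rw [exec, exec, NatExpr.eval_tick]
    simp only [State.writeNat, State.tick, Nat.add_right_comm]

theorem Program.exec_seq (P Q : Program) (s : State) :
    (seq P Q).exec ans s = (Q.exec ans (P.exec ans s)).tick 1 := by
  rw [exec, exec_tick, exec_tick]

theorem Program.exec_cond_of_holds {b : Cond} {P Q : Program} {s : State} (h : b.Holds s) :
    (cond b P Q).exec ans s = (P.exec ans s).tick (b.time + 1) := by
  rw [exec, if_pos h, exec_tick]

theorem Program.exec_cond_of_not_holds {b : Cond} {P Q : Program} {s : State}
    (h : ¬ b.Holds s) : (cond b P Q).exec ans s = (Q.exec ans s).tick (b.time + 1) := by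
  rw [exec, if_neg h, exec_tick]

section Components

variable (s : State)

theorem State.nat_tick (t : ℕ) : (s.tick t).nat = s.nat := rfl

theorem State.real_tick (t : ℕ) : (s.tick t).real = s.real := rfl

theorem State.log_tick (t : ℕ) : (s.tick t).log = s.log := rfl

namespace Program

theorem nat_skip : (skip.exec ans s).nat = s.nat := rfl

theorem real_skip : (skip.exec ans s).real = s.real := rfl

theorem nat_seq (P Q : Program) :
    ((seq P Q).exec ans s).nat = (Q.exec ans (P.exec ans s)).nat := by
  rw [exec_seq, State.nat_tick]

theorem real_seq (P Q : Program) :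
    ((seq P Q).exec ans s).real = (Q.exec ans (P.exec ans s)).real := by
  rw [exec_seq, State.real_tick]

open Classical in
theorem nat_cond (b : Cond) (P Q : Program) (a i j : ℕ) :
    ((cond b P Q).exec ans s).nat a i j =
      if b.Holds s then (P.exec ans s).nat a i j else (Q.exec ans s).nat a i j := by
  rw [exec, exec_tick, exec_tick, apply_ite State.nat, State.nat_tick, State.nat_tick]
  split_ifs <;> rfl

open Classical in
theorem real_cond (b : Cond) (P Q : Program) (a i j : ℕ) :
    ((cond b P Q).exec ans s).real a i j =
      if b.Holds s then (P.exec ans s).real a i j else (Q.exec ans s).real a i j := by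
  rw [exec, exec_tick, exec_tick, apply_ite State.real, State.real_tick, State.real_tick]
  split_ifs <;> rfl

theorem nat_setNat (a : ℕ) (i j x : NatExpr) :
    ((setNat a i j x).exec ans s).nat = (s.writeNat a (i.eval s) (j.eval s) (x.eval s)).nat :=
  rfl

theorem real_setNat (a : ℕ) (i j x : NatExpr) : ((setNat a i j x).exec ans s).real = s.real :=
  rfl

theorem nat_setReal (a : ℕ) (i j : NatExpr) (x : RealExpr) :
    ((setReal a i j x).exec ans s).nat = s.nat := rfl

theorem real_setReal (a : ℕ) (i j : NatExpr) (x : RealExpr) :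
    ((setReal a i j x).exec ans s).real =
      (s.writeReal a (i.eval s) (j.eval s) (x.eval s)).real := rfl

end Program

theorem State.nat_writeNat (a i j v a' i' j' : ℕ) :
    (s.writeNat a i j v).nat a' i' j' =
      if a' = a ∧ i' = i ∧ j' = j then v else s.nat a' i' j' := rfl

theorem State.real_writeNat (a i j v : ℕ) : (s.writeNat a i j v).real = s.real := rfl

theorem State.real_writeReal (a i j : ℕ) (v : ℝ) (a' i' j' : ℕ) :
    (s.writeReal a i j v).real a' i' j' =
      if a' = a ∧ i' = i ∧ j' = j then v else s.real a' i' j' := rfl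

end Components

/-- Loop rule: an invariant, which may use that arrays not written and the log are unchanged. -/
theorem Program.exec_loop {a : ℕ} {x : NatExpr} {body : Program} {s : State}
    (Inv : ℕ → State → Prop) (h0 : Inv 0 (s.tick (x.time + 1)))
    (hstep : ∀ t < x.eval s, ∀ s' : State,
      (∀ b ∉ (loop a x body).natArrays, s'.nat b = s.nat b) →
      (∀ b ∉ (loop a x body).realArrays, s'.real b = s.real b) →
      Inv t s' → Inv (t + 1) ((body.exec ans (s'.writeNat a 0 0 t)).tick 1)) :
    Inv (x.eval s) ((loop a x body).exec ans s) := by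
  rw [exec]
  -- Induction over the first `t` rounds, carrying the frame conditions along with the invariant.
  suffices h : ∀ t ≤ x.eval s, ∀ s', s' = (List.range t).foldl
      (fun s' t => body.exec ans ((s'.writeNat a 0 0 t).tick 1)) (s.tick (x.time + 1)) →
      (∀ b ∉ (loop a x body).natArrays, s'.nat b = s.nat b) ∧
      (∀ b ∉ (loop a x body).realArrays, s'.real b = s.real b) ∧ Inv t s' from
    (h _ le_rfl _ rfl).2.2
  intro t
  induction t with
  | zero =>
    rintro - s' rfl
    exact ⟨fun _ _ => rfl, fun _ _ => rfl, h0⟩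
  | succ t ih =>
    rintro ht s' rfl
    obtain ⟨h1, h2, h3⟩ := ih (by omega) _ rfl
    rw [List.range_succ, List.foldl_append, List.foldl_cons, List.foldl_nil, exec_tick]
    refine ⟨fun b hb => ?_, fun b hb => ?_, hstep t (by omega) _ h1 h2 h3⟩
    · rw [State.nat_tick, exec_nat body (fun hc => hb (List.mem_cons_of_mem _ hc)), ← h1 b hb]
      have : b ≠ a := fun hc => hb (hc ▸ List.mem_cons_self)
      funext x y
      simp [State.writeNat, this]
    · rw [State.real_tick, exec_real body hb, ← h2 b hb]
      rfl

/-! ### Polynomial bound on the number of steps -/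

namespace Program

/-- Every loop has one of the dimensions stored in array `0` as its bound, and array `0` is never
written. -/
def dimBounded : Program → Prop
  | seq P Q => P.dimBounded ∧ Q.dimBounded
  | cond _ P Q => P.dimBounded ∧ Q.dimBounded
  | loop a x body => a ≠ 0 ∧ (∃ c, x = .read 0 (.const 0) (.const c)) ∧ body.dimBounded
  | setNat a _ _ _ => a ≠ 0
  | perform a _ => a ≠ 0
  | _ => True

/-- A weight that bounds the running time together with the loop depth. -/
def size : Program → ℕ
  | skip => 1
  | setNat _ i j x => i.time + j.time + x.time + 1
  | setReal _ i j x => i.time + j.time + x.time + 1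
  | seq P Q => 1 + P.size + Q.size
  | cond b P Q => b.time + 1 + P.size + Q.size
  | loop _ x body => x.time + 1 + (1 + body.size)
  | perform _ x => x.time + 1

/-- The nesting depth of the loops. -/
def depth : Program → ℕ
  | seq P Q => max P.depth Q.depth
  | cond _ P Q => max P.depth Q.depth
  | loop _ _ body => body.depth + 1
  | _ => 0

theorem notMem_natArrays_of_dimBounded {P : Program} (hP : P.dimBounded) :
    0 ∉ P.natArrays := by
  induction P with
  | skip => simp [natArrays]
  | setNat b i j x => simpa [natArrays] using Ne.symm hP
  | setReal b i j x => simp [natArrays]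
  | seq P Q ihP ihQ => simpa [natArrays] using ⟨ihP hP.1, ihQ hP.2⟩
  | cond b P Q ihP ihQ => simpa [natArrays] using ⟨ihP hP.1, ihQ hP.2⟩
  | loop b x body ih => simpa [natArrays] using ⟨Ne.symm hP.1, ih hP.2.2⟩
  | perform b x => simpa [natArrays] using Ne.symm hP

theorem foldl_steps_le {α : Type*} {f : State → α → State} {q : State → Prop} {B : ℕ}
    (hf : ∀ s x, q s → q (f s x) ∧ (f s x).steps ≤ s.steps + B) (l : List α) (s : State)
    (hs : q s) : (l.foldl f s).steps ≤ s.steps + l.length * B := by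
  induction l generalizing s with
  | nil => simp
  | cons x l ih =>
    have h1 := hf s x hs
    have h2 := ih _ h1.1
    rw [List.foldl_cons, List.length_cons]
    linarith

/-- Loop bounds are read from array `0`, which never changes, so each loop makes at most `N` rounds
and each nesting level costs a factor `N`. As `N ≥ 1`, smaller powers are absorbed into the largest.
-/
theorem steps_exec_le {P : Program} (hP : P.dimBounded) {N : ℕ} (hN : 1 ≤ N) {s : State}
    (hs : ∀ c, s.nat 0 0 c ≤ N) :
    (P.exec ans s).steps ≤ s.steps + P.size * N ^ P.depth := by
  induction P generalizing s with
  | skip => simp [exec, State.tick, size, depth]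
  | setNat b i j x => simp [exec, State.writeNat, State.tick, size, depth]
  | setReal b i j x => simp [exec, State.writeReal, State.tick, size, depth]
  | seq P Q ihP ihQ =>
    have h1 := ihP hP.1 (s := s.tick 1) hs
    have h2 := ihQ hP.2 (s := P.exec ans (s.tick 1)) (by
      rw [exec_nat P (notMem_natArrays_of_dimBounded hP.1)]; exact hs)
    have h3 : N ^ P.depth ≤ N ^ (max P.depth Q.depth) :=
      Nat.pow_le_pow_right hN (le_max_left _ _)
    have h4 : N ^ Q.depth ≤ N ^ (max P.depth Q.depth) :=
      Nat.pow_le_pow_right hN (le_max_right _ _)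
    have h5 : 1 ≤ N ^ (max P.depth Q.depth) := Nat.one_le_pow _ _ hN
    have h6 : (s.tick 1).steps = s.steps + 1 := rfl
    rw [exec, size, depth]
    nlinarith [Nat.mul_le_mul_left P.size h3, Nat.mul_le_mul_left Q.size h4]
  | cond b P Q ihP ihQ =>
    have h1 := ihP hP.1 (s := s.tick (b.time + 1)) hs
    have h2 := ihQ hP.2 (s := s.tick (b.time + 1)) hs
    have h3 : N ^ P.depth ≤ N ^ (max P.depth Q.depth) :=
      Nat.pow_le_pow_right hN (le_max_left _ _)
    have h4 : N ^ Q.depth ≤ N ^ (max P.depth Q.depth) :=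
      Nat.pow_le_pow_right hN (le_max_right _ _)
    have h5 : 1 ≤ N ^ (max P.depth Q.depth) := Nat.one_le_pow _ _ hN
    have h6 : (s.tick (b.time + 1)).steps = s.steps + (b.time + 1) := rfl
    have h7 := Nat.mul_le_mul_left P.size h3
    have h8 := Nat.mul_le_mul_left Q.size h4
    have h9 := Nat.mul_le_mul_left (b.time + 1) h5
    rw [exec, size, depth, add_mul, add_mul]
    split_ifs <;> omega
  | loop b x body ih =>
    obtain ⟨hb, ⟨c, rfl⟩, hbody⟩ := hP
    have h0 : 0 ∉ body.natArrays := notMem_natArrays_of_dimBounded hbody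
    have h1 := foldl_steps_le (f := fun s' t => body.exec ans ((s'.writeNat b 0 0 t).tick 1))
      (q := fun s => ∀ c, s.nat 0 0 c ≤ N) (B := 1 + body.size * N ^ body.depth)
      (fun s t hq => by
        have hq' : ∀ c, ((s.writeNat b 0 0 t).tick 1).nat 0 0 c ≤ N := by
          simpa [State.writeNat, State.tick, hb.symm] using hq
        refine ⟨by rw [exec_nat body h0]; exact hq', (ih hbody hq').trans_eq ?_⟩
        rw [← add_assoc]
        rfl) (List.range (NatExpr.eval s (.read 0 (.const 0) (.const c))))
      (s.tick (NatExpr.time (.read 0 (.const 0) (.const c)) + 1)) hs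
    rw [exec, size, depth]
    refine h1.trans ?_
    have h2 : NatExpr.eval s (.read 0 (.const 0) (.const c)) ≤ N := hs c
    rw [List.length_range]
    have h3 := Nat.mul_le_mul_right (1 + body.size * N ^ body.depth) h2
    have h4 : 1 ≤ N ^ body.depth := Nat.one_le_pow _ _ hN
    have h5 : 1 ≤ N ^ (body.depth + 1) := Nat.one_le_pow _ _ hN
    have h6 := Nat.mul_le_mul_left N h4
    have h7 := Nat.mul_le_mul_left (NatExpr.time (.read 0 (.const 0) (.const c)) + 1) h5
    have h8 : N ^ (body.depth + 1) = N * N ^ body.depth := pow_succ' _ _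
    have h9 : (s.tick (NatExpr.time (.read 0 (.const 0) (.const c)) + 1)).steps =
      s.steps + (NatExpr.time (.read 0 (.const 0) (.const c)) + 1) := rfl
    rw [h9]
    nlinarith
  | perform b x => simp [exec, State.writeNat, State.tick, size, depth]

end Program

end RealRAM

/-! ### The greedy program -/

namespace RealRAM

/-- The natural number stored at entry `(0, 0)` of array `a`. -/
abbrev NatExpr.var (a : ℕ) : NatExpr := .read a (.const 0) (.const 0)

/-- The real number stored at entry `(0, 0)` of array `a`. -/
abbrev RealExpr.var (a : ℕ) : RealExpr := .read a (.const 0) (.const 0)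

/-- Assignment to a natural-number variable. -/
abbrev Program.assignNat (a : ℕ) (x : NatExpr) : Program := .setNat a (.const 0) (.const 0) x

/-- Assignment to a real variable. -/
abbrev Program.assignReal (a : ℕ) (x : RealExpr) : Program := .setReal a (.const 0) (.const 0) x

end RealRAM

namespace Greedy

open RealRAM RealRAM.Program

/-! The greedy program. Natural-number arrays: `4` marks the eliminated hypotheses, `5` the
performed tests; loop counters are `10` (rounds), `11` (tests), `12` (hypotheses), `13` (regions)
and `14` (hypotheses); variables are `15` (some hypothesis lies outside the region), `16` (some
region contains all compatible hypotheses), `17` and `18` (sizes of the two sides), `19` (some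
candidate test was found), `20` (best candidate), `21` (outcome). Real variables: `2` and `3`
(weights of the two sides), `4` (score), `5`, `6` (numerator and denominator), `7` (product),
`8` (best score). -/

/-- Count the compatible hypotheses outside of region `13` (in variable `6`), and those among them
that agree with hypothesis `12` on test `11` (in variable `5`). -/
def countOutside : Program :=
  .seq (.assignReal 5 (.const 0)) <| .seq (.assignReal 6 (.const 0)) <|
  .loop 14 (.var 0) <|
    .cond (.natLe (.add (.read 4 (.var 14) (.const 0)) (.read 2 (.var 13) (.var 14))) (.const 0))
      (.seq (.assignReal 6 (.add (.var 6) (.const 1)))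
        (.cond (.natLe (.add
            (.sub (.read 1 (.var 11) (.var 14)) (.read 1 (.var 11) (.var 12)))
            (.sub (.read 1 (.var 11) (.var 12)) (.read 1 (.var 11) (.var 14)))) (.const 0))
          (.assignReal 5 (.add (.var 5) (.const 1))) .skip))
      .skip

/-- Compute in variable `7` the factor by which test `11` reduces the uncovered part of the utility
of hypothesis `12`. -/
def remainingFactor : Program :=
  .seq (.assignReal 7 (.const 1)) <|
  .loop 13 (.read 0 (.const 0) (.const 2)) <|
    .cond (.natLe (.const 1) (.read 2 (.var 13) (.var 12)))
      (.seq countOutside (.assignReal 7 (.mul (.var 7) (.div (.var 5) (.var 6)))))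
      .skip

/-- Compute in variable `4` the weight of the smaller side of the split by test `11`. -/
def smallSide : Program :=
  .seq (.assignNat 17 (.const 0)) <| .seq (.assignNat 18 (.const 0)) <|
  .seq (.assignReal 2 (.const 0)) <| .seq (.assignReal 3 (.const 0)) <|
  .seq (.loop 12 (.var 0) <|
    .cond (.natLe (.read 4 (.var 12) (.const 0)) (.const 0))
      (.cond (.natLe (.const 1) (.read 1 (.var 11) (.var 12)))
        (.seq (.assignNat 17 (.add (.var 17) (.const 1)))
          (.assignReal 2 (.add (.var 2) (.read 0 (.var 12) (.const 0)))))
        (.seq (.assignNat 18 (.add (.var 18) (.const 1)))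
          (.assignReal 3 (.add (.var 3) (.read 0 (.var 12) (.const 0))))))
      .skip)
  (.cond (.natLe (.var 17) (.var 18)) (.assignReal 4 (.var 2)) (.assignReal 4 (.var 3)))

/-- Add to variable `4` the weighted relative gains of test `11`. -/
def addGains : Program :=
  .loop 12 (.var 0) <|
    .cond (.natLe (.read 4 (.var 12) (.const 0)) (.const 0))
      (.seq remainingFactor (.assignReal 4 (.add (.var 4)
        (.mul (.read 0 (.var 12) (.const 0)) (.sub (.const 1) (.var 7))))))
      .skip

/-- Compute in variable `4` the score of test `11`. -/
def computeScore : Program :=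
  .seq smallSide <| .seq addGains <|
    .assignReal 4 (.div (.var 4) (.read 1 (.var 11) (.const 0)))

/-- Find in variable `20` a test of maximum score that was not performed. -/
def findTest : Program :=
  .seq (.assignNat 19 (.const 0)) <|
  .loop 11 (.read 0 (.const 0) (.const 1)) <|
    .cond (.natLe (.read 5 (.var 11) (.const 0)) (.const 0))
      (.seq computeScore <|
        .cond (.natLe (.const 1) (.var 19))
          (.cond (.realLe (.var 8) (.var 4))
            (.seq (.assignReal 8 (.var 4)) (.assignNat 20 (.var 11))) .skip)
          (.seq (.assignNat 19 (.const 1))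
            (.seq (.assignReal 8 (.var 4)) (.assignNat 20 (.var 11)))))
      .skip

/-- Find in variable `3` the last region that contains all compatible hypotheses, and set variable
`16` if there is one. -/
def findRegion : Program :=
  .seq (.assignNat 3 (.const 0)) <| .seq (.assignNat 16 (.const 0)) <|
  .loop 13 (.read 0 (.const 0) (.const 2)) <|
    .seq (.assignNat 15 (.const 0)) <|
    .seq (.loop 14 (.var 0) <|
      .cond (.natLe (.add (.read 4 (.var 14) (.const 0)) (.read 2 (.var 13) (.var 14)))
          (.const 0))
        (.assignNat 15 (.const 1)) .skip)
    (.cond (.natLe (.var 15) (.const 0))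
      (.seq (.assignNat 3 (.var 13)) (.assignNat 16 (.const 1))) .skip)

/-- Mark test `20` as performed and eliminate the hypotheses that contradict its outcome. -/
def update : Program :=
  .seq (.setNat 5 (.var 20) (.const 0) (.const 1)) <|
  .loop 12 (.var 0) <|
    .cond (.natLe (.add (.sub (.read 1 (.var 20) (.var 12)) (.var 21))
        (.sub (.var 21) (.read 1 (.var 20) (.var 12)))) (.const 0))
      .skip (.setNat 4 (.var 12) (.const 0) (.const 1))

/-- A round of the greedy algorithm. -/
def round : Program :=
  .seq findRegion <|
    .cond (.natLe (.const 1) (.var 16)) .skip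
      (.seq findTest (.seq (.perform 21 (.var 20)) update))

/-- The greedy program. -/
def program : Program :=
  .seq (.loop 10 (.read 0 (.const 0) (.const 1)) round) findRegion

/-! ### Values computed by the subroutines -/

open Finset

variable {ans : ℕ → Bool}

/-- The number of compatible hypotheses outside of region `j`. -/
def outsideVal (s : State) (j : ℕ) : ℝ :=
  ∑ h ∈ range (s.nat 0 0 0), if s.nat 4 h 0 = 0 ∧ s.nat 2 j h = 0 then 1 else 0

/-- The number of compatible hypotheses outside of region `j` that agree with `i` on test `e`. -/
def agreeVal (s : State) (e i j : ℕ) : ℝ :=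
  ∑ h ∈ range (s.nat 0 0 0),
    if (s.nat 4 h 0 = 0 ∧ s.nat 2 j h = 0) ∧ s.nat 1 e h = s.nat 1 e i then 1 else 0

/-- The factor by which test `e` reduces the uncovered part of the utility of hypothesis `i`. -/
def factorVal (s : State) (e i : ℕ) : ℝ :=
  ∏ j ∈ range (s.nat 0 0 2),
    if 1 ≤ s.nat 2 j i then agreeVal s e i j / outsideVal s j else 1

theorem exec_countOutside (s : State) :
    (countOutside.exec ans s).real 5 0 0 =
        agreeVal s (s.nat 11 0 0) (s.nat 12 0 0) (s.nat 13 0 0) ∧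
      (countOutside.exec ans s).real 6 0 0 = outsideVal s (s.nat 13 0 0) := by
  simp only [countOutside, real_seq]
  refine exec_loop (fun t s' => s'.real 5 0 0 = ∑ h ∈ range t,
      (if (s.nat 4 h 0 = 0 ∧ s.nat 2 (s.nat 13 0 0) h = 0) ∧
        s.nat 1 (s.nat 11 0 0) h = s.nat 1 (s.nat 11 0 0) (s.nat 12 0 0) then 1 else 0) ∧
    s'.real 6 0 0 = ∑ h ∈ range t,
      (if s.nat 4 h 0 = 0 ∧ s.nat 2 (s.nat 13 0 0) h = 0 then 1 else 0)) ?_ ?_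
  · simp [exec, NatExpr.eval, RealExpr.eval, State.writeReal, State.tick]
  · rintro t - s' hn - ⟨h1, h2⟩
    have e1 := hn 1 (by decide)
    have e2 := hn 2 (by decide)
    have e4 := hn 4 (by decide)
    have e11 := hn 11 (by decide)
    have e12 := hn 12 (by decide)
    have e13 := hn 13 (by decide)
    simp only [nat_setReal] at e1 e2 e4 e11 e12 e13
    -- The machine only compares by `≤`, so the program tests equality through the two truncated
    -- differences.
    have hk : ∀ a b : ℕ, a - b + (b - a) ≤ 0 ↔ a = b := by omega
    rw [sum_range_succ, sum_range_succ, ← h1, ← h2]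
    clear h1 h2 hn
    simp [State.real_tick, real_cond, real_seq, real_setReal, nat_setReal, real_skip, Cond.Holds,
      NatExpr.eval, RealExpr.eval, State.real_writeReal, State.nat_writeNat, State.real_writeNat,
      e1, e2, e4, e11, e12, e13, hk]
    split_ifs <;> simp_all

/-- The two states have the same input and the same record of the tests performed. -/
structure SameData (s s' : State) : Prop where
  dim : s'.nat 0 = s.nat 0
  test : s'.nat 1 = s.nat 1
  region : s'.nat 2 = s.nat 2
  dead : s'.nat 4 = s.nat 4
  used : s'.nat 5 = s.nat 5
  prob : s'.real 0 = s.real 0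
  cost : s'.real 1 = s.real 1

theorem SameData.of_frame {s s' : State} {A B : List ℕ} (hn : ∀ b ∉ A, s'.nat b = s.nat b)
    (hr : ∀ b ∉ B, s'.real b = s.real b)
    (hA : ∀ b ∈ [0, 1, 2, 4, 5], b ∉ A) (hB : ∀ b ∈ [0, 1], b ∉ B) : SameData s s' where
  dim := hn _ (hA _ (by decide))
  test := hn _ (hA _ (by decide))
  region := hn _ (hA _ (by decide))
  dead := hn _ (hA _ (by decide))
  used := hn _ (hA _ (by decide))
  prob := hr _ (hB _ (by decide))
  cost := hr _ (hB _ (by decide))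

theorem SameData.exec {P : Program} (hA : ∀ b ∈ [0, 1, 2, 4, 5], b ∉ P.natArrays)
    (hB : ∀ b ∈ [0, 1], b ∉ P.realArrays) (s : State) : SameData s (P.exec ans s) :=
  .of_frame (fun _ hb => exec_nat P hb s) (fun _ hb => exec_real P hb s) hA hB

theorem SameData.outsideVal {s s' : State} (h : SameData s s') :
    outsideVal s' = outsideVal s := by
  funext j
  simp only [Greedy.outsideVal, h.dim, h.region, h.dead]

theorem SameData.agreeVal {s s' : State} (h : SameData s s') : agreeVal s' = agreeVal s := by
  funext e i j
  simp only [Greedy.agreeVal, h.dim, h.test, h.region, h.dead]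

theorem SameData.factorVal {s s' : State} (h : SameData s s') :
    factorVal s' = factorVal s := by
  funext e i
  simp only [Greedy.factorVal, h.dim, h.region, h.agreeVal, h.outsideVal]

theorem SameData.trans {s t u : State} (h : SameData s t) (h' : SameData t u) :
    SameData s u where
  dim := h'.dim.trans h.dim
  test := h'.test.trans h.test
  region := h'.region.trans h.region
  dead := h'.dead.trans h.dead
  used := h'.used.trans h.used
  prob := h'.prob.trans h.prob
  cost := h'.cost.trans h.cost

theorem SameData.writeNat {s s' : State} (h : SameData s s') {a : ℕ}
    (ha : a ∉ [0, 1, 2, 4, 5]) (t : ℕ) : SameData s (s'.writeNat a 0 0 t) := by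
  refine h.trans (.of_frame (A := [a]) (B := []) (fun b hb => ?_) (fun _ _ => rfl)
    (fun b hb => ?_) (by simp))
  · have : b ≠ a := by simpa using hb
    funext x y
    simp [State.writeNat, this]
  · rintro hc
    rw [List.mem_singleton] at hc
    exact ha (hc ▸ hb)

theorem exec_remainingFactor (s : State) :
    (remainingFactor.exec ans s).real 7 0 0 = factorVal s (s.nat 11 0 0) (s.nat 12 0 0) := by
  simp only [remainingFactor, real_seq]
  refine exec_loop (fun t s' => s'.real 7 0 0 = ∏ j ∈ range t,
      if 1 ≤ s.nat 2 j (s.nat 12 0 0) then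
        agreeVal s (s.nat 11 0 0) (s.nat 12 0 0) j / outsideVal s j else 1) ?_ ?_
  · simp [real_setReal, RealExpr.eval, NatExpr.eval, State.real_writeReal, State.real_tick]
  · rintro t - s' hn hr h1
    have hd : SameData s s' := (SameData.exec (P := .assignReal 7 (.const 1)) (ans := ans)
      (by decide) (by decide) _).trans (.of_frame hn hr (by decide) (by decide))
    have e11 := hn 11 (by decide)
    have e12 := hn 12 (by decide)
    simp only [nat_setReal] at e11 e12
    have hd' : SameData s (s'.writeNat 13 0 0 t) := hd.writeNat (by decide) t
    have hc := exec_countOutside (ans := ans) (s'.writeNat 13 0 0 t)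
    have h7 := exec_real (ans := ans) countOutside (a := 7) (by decide) (s'.writeNat 13 0 0 t)
    rw [hd'.agreeVal, hd'.outsideVal] at hc
    simp only [State.nat_writeNat, State.real_writeNat] at hc h7
    rw [prod_range_succ, ← h1, State.real_tick, real_cond, real_seq]
    generalize countOutside.exec ans _ = u at hc h7
    clear h1 hn hr
    simp [Cond.Holds, real_setReal, real_skip, RealExpr.eval, NatExpr.eval,
      State.nat_writeNat, State.real_writeNat, hd.region, e12]
    split_ifs <;> simp_all [State.real_writeReal]

/-- The number of compatible hypotheses for which test `e` is positive. -/
def yesCount (s : State) (e : ℕ) : ℕ :=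
  ∑ h ∈ range (s.nat 0 0 0), if s.nat 4 h 0 = 0 ∧ 1 ≤ s.nat 1 e h then 1 else 0

/-- The number of compatible hypotheses for which test `e` is negative. -/
def noCount (s : State) (e : ℕ) : ℕ :=
  ∑ h ∈ range (s.nat 0 0 0), if s.nat 4 h 0 = 0 ∧ ¬ 1 ≤ s.nat 1 e h then 1 else 0

/-- The weight of the compatible hypotheses for which test `e` is positive. -/
def yesWeight (s : State) (e : ℕ) : ℝ :=
  ∑ h ∈ range (s.nat 0 0 0), if s.nat 4 h 0 = 0 ∧ 1 ≤ s.nat 1 e h then s.real 0 h 0 else 0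

/-- The weight of the compatible hypotheses for which test `e` is negative. -/
def noWeight (s : State) (e : ℕ) : ℝ :=
  ∑ h ∈ range (s.nat 0 0 0), if s.nat 4 h 0 = 0 ∧ ¬ 1 ≤ s.nat 1 e h then s.real 0 h 0 else 0

/-- The weight of the smaller side of the split by test `e`. -/
def smallVal (s : State) (e : ℕ) : ℝ :=
  if yesCount s e ≤ noCount s e then yesWeight s e else noWeight s e

/-- The weighted relative gains of test `e`. -/
def gainsVal (s : State) (e : ℕ) : ℝ :=
  ∑ i ∈ range (s.nat 0 0 0), if s.nat 4 i 0 = 0 then s.real 0 i 0 * (1 - factorVal s e i) else 0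

/-- The score of test `e`. -/
def scoreVal (s : State) (e : ℕ) : ℝ := (smallVal s e + gainsVal s e) / s.real 1 e 0

theorem SameData.smallVal {s s' : State} (h : SameData s s') : smallVal s' = smallVal s := by
  funext e
  have h1 : yesCount s' e = yesCount s e := by simp only [yesCount, h.dim, h.test, h.dead]
  have h2 : noCount s' e = noCount s e := by simp only [noCount, h.dim, h.test, h.dead]
  have h3 : yesWeight s' e = yesWeight s e := by
    simp only [yesWeight, h.dim, h.test, h.dead, h.prob]
  have h4 : noWeight s' e = noWeight s e := by
    simp only [noWeight, h.dim, h.test, h.dead, h.prob]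
  rw [Greedy.smallVal, h1, h2, h3, h4, Greedy.smallVal]

theorem SameData.gainsVal {s s' : State} (h : SameData s s') : gainsVal s' = gainsVal s := by
  funext e
  simp only [Greedy.gainsVal, h.dim, h.dead, h.prob, h.factorVal]

theorem SameData.scoreVal {s s' : State} (h : SameData s s') : scoreVal s' = scoreVal s := by
  funext e
  simp only [Greedy.scoreVal, h.smallVal, h.gainsVal, h.cost]

theorem exec_smallSide (s : State) :
    (smallSide.exec ans s).real 4 0 0 = smallVal s (s.nat 11 0 0) := by
  simp only [smallSide, real_seq, real_cond]
  generalize hs0 : (assignReal 3 (.const 0)).exec ans ((assignReal 2 (.const 0)).exec ans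
    ((assignNat 18 (.const 0)).exec ans ((assignNat 17 (.const 0)).exec ans s))) = s0
  have hd0 : SameData s s0 := hs0 ▸ (SameData.exec (P := .assignNat 17 (.const 0)) (ans := ans)
    (by decide) (by decide) _).trans ((SameData.exec (P := .assignNat 18 (.const 0)) (ans := ans)
    (by decide) (by decide) _).trans ((SameData.exec (P := .assignReal 2 (.const 0)) (ans := ans)
    (by decide) (by decide) _).trans (SameData.exec (P := .assignReal 3 (.const 0)) (ans := ans)
    (by decide) (by decide) _)))
  have h11 : s0.nat 11 0 0 = s.nat 11 0 0 := by
    simp [← hs0, nat_setNat, nat_setReal, State.nat_writeNat]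
  have hv : s0.nat 17 0 0 = 0 ∧ s0.nat 18 0 0 = 0 ∧ s0.real 2 0 0 = 0 ∧ s0.real 3 0 0 = 0 := by
    simp [← hs0, nat_setNat, nat_setReal, real_setReal, State.nat_writeNat, State.real_writeReal,
      NatExpr.eval, RealExpr.eval]
  clear hs0
  rw [← hd0.smallVal, ← h11]
  have key := exec_loop (ans := ans) (a := 12) (x := .var 0) (s := s0)
    (body := .cond (.natLe (.read 4 (.var 12) (.const 0)) (.const 0))
      (.cond (.natLe (.const 1) (.read 1 (.var 11) (.var 12)))
        (.seq (.assignNat 17 (.add (.var 17) (.const 1)))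
          (.assignReal 2 (.add (.var 2) (.read 0 (.var 12) (.const 0)))))
        (.seq (.assignNat 18 (.add (.var 18) (.const 1)))
          (.assignReal 3 (.add (.var 3) (.read 0 (.var 12) (.const 0))))))
      .skip)
    (fun t s' =>
      s'.nat 17 0 0 = ∑ h ∈ range t,
        (if s0.nat 4 h 0 = 0 ∧ 1 ≤ s0.nat 1 (s0.nat 11 0 0) h then 1 else 0) ∧
      s'.nat 18 0 0 = ∑ h ∈ range t,
        (if s0.nat 4 h 0 = 0 ∧ ¬ 1 ≤ s0.nat 1 (s0.nat 11 0 0) h then 1 else 0) ∧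
      s'.real 2 0 0 = ∑ h ∈ range t,
        (if s0.nat 4 h 0 = 0 ∧ 1 ≤ s0.nat 1 (s0.nat 11 0 0) h then s0.real 0 h 0 else 0) ∧
      s'.real 3 0 0 = ∑ h ∈ range t,
        (if s0.nat 4 h 0 = 0 ∧ ¬ 1 ≤ s0.nat 1 (s0.nat 11 0 0) h then s0.real 0 h 0 else 0))
    (by simpa [State.nat_tick, State.real_tick] using hv) (by
      rintro t - s' hn hr ⟨h1, h2, h3, h4⟩
      have e1 := hn 1 (by decide)
      have e4 := hn 4 (by decide)
      have e11 := hn 11 (by decide)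
      have r0 := hr 0 (by decide)
      rw [sum_range_succ, sum_range_succ, sum_range_succ, sum_range_succ, ← h1, ← h2, ← h3, ← h4]
      clear h1 h2 h3 h4 hn hr
      simp [State.real_tick, State.nat_tick, real_cond, nat_cond, real_seq, nat_seq, real_setReal,
        nat_setReal, nat_setNat, real_setNat, real_skip, nat_skip, Cond.Holds, NatExpr.eval,
        RealExpr.eval, State.real_writeReal, State.nat_writeNat, State.real_writeNat, e1, e4, e11,
        r0]
      split_ifs <;> simp_all)
  generalize exec ans _ s0 = u at key
  obtain ⟨h1, h2, h3, h4⟩ := key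
  simp only [NatExpr.eval] at h1 h2 h3 h4
  simp [Cond.Holds, NatExpr.eval, RealExpr.eval, real_setReal, State.real_writeReal, smallVal,
    yesCount, noCount, yesWeight, noWeight, h1, h2, h3, h4]

theorem exec_addGains (s : State) :
    (addGains.exec ans s).real 4 0 0 = s.real 4 0 0 + gainsVal s (s.nat 11 0 0) := by
  unfold addGains
  refine exec_loop (fun t s' => s'.real 4 0 0 = s.real 4 0 0 + ∑ i ∈ range t,
    if s.nat 4 i 0 = 0 then s.real 0 i 0 * (1 - factorVal s (s.nat 11 0 0) i) else 0) ?_ ?_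
  · simp [State.real_tick]
  · rintro t - s' hn hr h1
    have hd : SameData s s' := .of_frame hn hr (by decide) (by decide)
    have e11 := hn 11 (by decide)
    have hd' : SameData s (s'.writeNat 12 0 0 t) := hd.writeNat (by decide) t
    have hc := exec_remainingFactor (ans := ans) (s'.writeNat 12 0 0 t)
    have h4 := exec_real (ans := ans) remainingFactor (a := 4) (by decide) (s'.writeNat 12 0 0 t)
    have h0 := exec_real (ans := ans) remainingFactor (a := 0) (by decide) (s'.writeNat 12 0 0 t)
    have h12 := exec_nat (ans := ans) remainingFactor (a := 12) (by decide)
      (s'.writeNat 12 0 0 t)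
    rw [hd'.factorVal] at hc
    simp only [State.nat_writeNat, State.real_writeNat, hd.prob] at hc h4 h0
    rw [sum_range_succ, ← add_assoc, ← h1, State.real_tick, real_cond, real_seq]
    generalize remainingFactor.exec ans _ = u at hc h4 h0 h12
    clear h1 hn hr
    simp [Cond.Holds, real_setReal, real_skip, RealExpr.eval, NatExpr.eval,
      State.nat_writeNat, State.real_writeNat, hd.dead]
    split_ifs <;> simp_all [State.real_writeReal, State.nat_writeNat]

theorem exec_computeScore (s : State) :
    (computeScore.exec ans s).real 4 0 0 = scoreVal s (s.nat 11 0 0) := by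
  have h1 := exec_smallSide (ans := ans) s
  have h2 := exec_addGains (ans := ans) (smallSide.exec ans s)
  have hd : SameData s (smallSide.exec ans s) := .exec (by decide) (by decide) s
  rw [hd.gainsVal, h1, exec_nat smallSide (a := 11) (by decide)] at h2
  have hd' : SameData s (addGains.exec ans (smallSide.exec ans s)) :=
    hd.trans (.exec (by decide) (by decide) _)
  have h11 : (addGains.exec ans (smallSide.exec ans s)).nat 11 = s.nat 11 := by
    rw [exec_nat addGains (by decide), exec_nat smallSide (by decide)]
  simp [computeScore, real_seq, real_setReal, State.real_writeReal, RealExpr.eval, NatExpr.eval,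
    h2, h11, hd'.cost, scoreVal]

theorem exec_findTest (s : State) (hex : ∃ e < s.nat 0 0 1, s.nat 5 e 0 = 0) :
    (findTest.exec ans s).nat 20 0 0 < s.nat 0 0 1 ∧
    s.nat 5 ((findTest.exec ans s).nat 20 0 0) 0 = 0 ∧
    ∀ e < s.nat 0 0 1, s.nat 5 e 0 = 0 →
      scoreVal s e ≤ scoreVal s ((findTest.exec ans s).nat 20 0 0) := by
  rw [findTest, nat_seq]
  have key := exec_loop (ans := ans) (a := 11) (x := .read 0 (.const 0) (.const 1))
    (s := (assignNat 19 (.const 0)).exec ans s)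
    (body := .cond (.natLe (.read 5 (.var 11) (.const 0)) (.const 0))
      (.seq computeScore <|
        .cond (.natLe (.const 1) (.var 19))
          (.cond (.realLe (.var 8) (.var 4))
            (.seq (.assignReal 8 (.var 4)) (.assignNat 20 (.var 11))) .skip)
          (.seq (.assignNat 19 (.const 1))
            (.seq (.assignReal 8 (.var 4)) (.assignNat 20 (.var 11)))))
      .skip)
    -- Flag `19` tells whether variables `8` and `20` hold a candidate of the current search; while
    -- it is `0` their contents are irrelevant and may be left from an earlier round.
    (fun t s' =>
      (s'.nat 19 0 0 = 0 ∧ ∀ e < t, s.nat 5 e 0 ≠ 0) ∨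
      (s'.nat 19 0 0 = 1 ∧ s'.nat 20 0 0 < t ∧ s.nat 5 (s'.nat 20 0 0) 0 = 0 ∧
        s'.real 8 0 0 = scoreVal s (s'.nat 20 0 0) ∧
        ∀ e < t, s.nat 5 e 0 = 0 → scoreVal s e ≤ s'.real 8 0 0))
    (.inl (by simp [State.nat_tick, nat_setNat, State.nat_writeNat, NatExpr.eval])) (by
      rintro t - s' hn hr h1
      have hd : SameData s s' := (SameData.exec (P := .assignNat 19 (.const 0)) (ans := ans)
        (by decide) (by decide) _).trans (.of_frame hn hr (by decide) (by decide))
      have hd' : SameData s (s'.writeNat 11 0 0 t) := hd.writeNat (by decide) t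
      have hc := exec_computeScore (ans := ans) (s'.writeNat 11 0 0 t)
      have h8 := exec_real (ans := ans) computeScore (a := 8) (by decide) (s'.writeNat 11 0 0 t)
      have h11 := exec_nat (ans := ans) computeScore (a := 11) (by decide)
        (s'.writeNat 11 0 0 t)
      have h19 := exec_nat (ans := ans) computeScore (a := 19) (by decide)
        (s'.writeNat 11 0 0 t)
      have h20 := exec_nat (ans := ans) computeScore (a := 20) (by decide)
        (s'.writeNat 11 0 0 t)
      rw [hd'.scoreVal] at hc
      replace h11 := congrFun (congrFun h11 0) 0
      replace h19 := congrFun (congrFun h19 0) 0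
      replace h20 := congrFun (congrFun h20 0) 0
      simp [State.nat_writeNat, State.real_writeNat] at hc h8 h11 h19 h20
      simp only [State.real_tick, State.nat_tick, real_cond, nat_cond, real_seq, nat_seq]
      generalize computeScore.exec ans _ = u at hc h8 h11 h19 h20
      clear hn hr
      have hlt : ∀ e, e < t + 1 ↔ e < t ∨ e = t := fun e => by omega
      by_cases hu : s.nat 5 t 0 = 0
      · rcases h1 with ⟨hf, h1⟩ | ⟨hf, h1, h2, h3, h4⟩
        · right
          simp [real_setReal, nat_setReal, nat_setNat, real_setNat, Cond.Holds,
            NatExpr.eval, RealExpr.eval, State.real_writeReal, State.nat_writeNat, hd.used, h11,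
            h19, hc, hu, hf, hlt]
          rintro e (he | rfl) h0
          · exact absurd h0 (h1 e he)
          · exact le_rfl
        · right
          by_cases hle : s'.real 8 0 0 ≤ scoreVal s t
          · simp [real_setReal, nat_setReal, nat_setNat, real_setNat, Cond.Holds,
              NatExpr.eval, RealExpr.eval, State.real_writeReal, State.nat_writeNat, hd.used, h8,
              h11, h19, hc, hu, hf, hlt, hle]
            rintro e (he | rfl) h0
            · exact (h4 e he h0).trans hle
            · exact le_rfl
          · simp [real_skip, nat_skip, Cond.Holds, NatExpr.eval, RealExpr.eval,
              State.nat_writeNat, hd.used, h8, h19, h20, hc, hu, hf, hlt, hle]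
            refine ⟨.inl h1, h2, h3, ?_⟩
            rintro e (he | rfl) h0
            · exact h4 e he h0
            · exact (not_le.1 hle).le
      · simp [real_skip, nat_skip, Cond.Holds, NatExpr.eval, State.nat_writeNat,
          State.real_writeNat, hd.used, hu, hlt]
        rcases h1 with ⟨hf, h1⟩ | ⟨hf, h1, h2, h3, h4⟩
        · left
          refine ⟨hf, ?_⟩
          rintro e (he | rfl)
          · exact h1 e he
          · exact hu
        · right
          refine ⟨hf, .inl h1, h2, h3, ?_⟩
          rintro e (he | rfl) h0
          · exact h4 e he h0
          · exact absurd h0 hu)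
  simp [NatExpr.eval, nat_setNat, State.nat_writeNat] at key
  generalize exec ans _ _ = u at key
  obtain ⟨e, he, h0⟩ := hex
  rcases key with ⟨_, h1⟩ | ⟨_, h1, h2, h3, h4⟩
  · exact absurd h0 (h1 e he)
  · exact ⟨h1, h2, fun e he h0 => h3 ▸ h4 e he h0⟩

/-- The compatible hypotheses all belong to region `j`. -/
def Good (s : State) (j : ℕ) : Prop := ∀ h < s.nat 0 0 0, ¬ (s.nat 4 h 0 = 0 ∧ s.nat 2 j h = 0)

theorem SameData.good {s s' : State} (h : SameData s s') : Good s' = Good s := by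
  funext j
  simp only [Greedy.Good, h.dim, h.region, h.dead]

open Classical in
/-- The last number below `t` with property `q`, or `0` if there is none. -/
def lastBelow (q : ℕ → Prop) : ℕ → ℕ
  | 0 => 0
  | t + 1 => if q t then t else lastBelow q t

theorem lastBelow_spec {q : ℕ → Prop} {t : ℕ} (h : ∃ j < t, q j) :
    lastBelow q t < t ∧ q (lastBelow q t) := by
  induction t with
  | zero => simp at h
  | succ t ih =>
    rw [lastBelow]
    split_ifs with ht
    · exact ⟨Nat.lt_succ_self t, ht⟩
    · obtain ⟨j, hj, hq⟩ := h
      have hjt : j ≠ t := fun hc => ht (hc ▸ hq)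
      have := ih ⟨j, by omega, hq⟩
      exact ⟨by omega, this.2⟩

/-- Each suitable region overwrites the previous one, so the last one survives. That variable `16`
is `0` or `1` decides the branch `1 ≤ ·` of a round in both directions. -/
theorem exec_findRegion (s : State) :
    (findRegion.exec ans s).nat 3 0 0 = lastBelow (Good s) (s.nat 0 0 2) ∧
    ((findRegion.exec ans s).nat 16 0 0 = 0 ∨ (findRegion.exec ans s).nat 16 0 0 = 1) ∧
    ((findRegion.exec ans s).nat 16 0 0 = 1 ↔ ∃ j < s.nat 0 0 2, Good s j) := by
  simp only [findRegion, nat_seq]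
  refine exec_loop (fun t s' => s'.nat 3 0 0 = lastBelow (Good s) t ∧
    (s'.nat 16 0 0 = 0 ∨ s'.nat 16 0 0 = 1) ∧
    (s'.nat 16 0 0 = 1 ↔ ∃ j < t, Good s j)) ?_ ?_
  · simp [lastBelow, State.nat_tick, nat_setNat, State.nat_writeNat, NatExpr.eval]
  · rintro t - s' hn hr ⟨h1, h2, h3⟩
    have hd : SameData s s' := (SameData.exec (P := .assignNat 3 (.const 0)) (ans := ans)
      (by decide) (by decide) _).trans ((SameData.exec (P := .assignNat 16 (.const 0))
      (ans := ans) (by decide) (by decide) _).trans (.of_frame hn hr (by decide) (by decide)))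
    generalize hs1 : (assignNat 15 (.const 0)).exec ans (s'.writeNat 13 0 0 t) = s1
    have hd1 : SameData s s1 := hs1 ▸ (hd.writeNat (by decide) t).trans
      (SameData.exec (by decide) (by decide) _)
    have e13 : s1.nat 13 0 0 = t := by
      simp [← hs1, nat_setNat, State.nat_writeNat]
    have e15 : s1.nat 15 0 0 = 0 := by
      simp [← hs1, nat_setNat, State.nat_writeNat, NatExpr.eval]
    have e3 : s1.nat 3 0 0 = s'.nat 3 0 0 := by
      simp [← hs1, nat_setNat, State.nat_writeNat]
    have e16 : s1.nat 16 0 0 = s'.nat 16 0 0 := by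
      simp [← hs1, nat_setNat, State.nat_writeNat]
    have key := exec_loop (ans := ans) (a := 14) (x := .var 0) (s := s1)
      (body := .cond (.natLe (.add (.read 4 (.var 14) (.const 0)) (.read 2 (.var 13) (.var 14)))
          (.const 0)) (.assignNat 15 (.const 1)) .skip)
      (fun d s' => s'.nat 15 0 0 = 0 ↔ ∀ h < d, ¬ (s.nat 4 h 0 = 0 ∧ s.nat 2 t h = 0))
      (by simp [State.nat_tick, e15]) (by
        rintro d - s' hn - h1
        have g4 := hn 4 (by decide)
        have g2 := hn 2 (by decide)
        have g13 := hn 13 (by decide)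
        have hlt : ∀ e, e < d + 1 ↔ e < d ∨ e = d := fun e => by omega
        simp only [hlt, or_imp, forall_and, forall_eq, ← h1]
        simp [State.nat_tick, nat_cond, nat_skip, nat_setNat, Cond.Holds, NatExpr.eval,
          State.nat_writeNat, g4, g2, g13, e13, hd1.dead, hd1.region]
        split_ifs with hc <;> simp_all)
    have u3 := exec_nat (ans := ans) (.loop 14 (.var 0)
      (.cond (.natLe (.add (.read 4 (.var 14) (.const 0)) (.read 2 (.var 13) (.var 14)))
          (.const 0)) (.assignNat 15 (.const 1)) .skip)) (a := 3) (by decide) s1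
    have u13 := exec_nat (ans := ans) (.loop 14 (.var 0)
      (.cond (.natLe (.add (.read 4 (.var 14) (.const 0)) (.read 2 (.var 13) (.var 14)))
          (.const 0)) (.assignNat 15 (.const 1)) .skip)) (a := 13) (by decide) s1
    have u16 := exec_nat (ans := ans) (.loop 14 (.var 0)
      (.cond (.natLe (.add (.read 4 (.var 14) (.const 0)) (.read 2 (.var 13) (.var 14)))
          (.const 0)) (.assignNat 15 (.const 1)) .skip)) (a := 16) (by decide) s1
    simp only [State.nat_tick, nat_seq, nat_cond, hs1]
    generalize exec ans (loop _ _ _) s1 = u at key u3 u13 u16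
    have hgood : u.nat 15 0 0 = 0 ↔ Good s t := by
      rw [key]
      simp only [Good, NatExpr.eval, hd1.dim]
    have hlt : ∀ e, e < t + 1 ↔ e < t ∨ e = t := fun e => by omega
    simp only [hlt, or_and_right, exists_or, exists_eq_left, ← h3, lastBelow, ← hgood, ← h1]
    clear hn hr hd hd1 key hgood
    by_cases h0 : u.nat 15 0 0 = 0
    · simp [nat_setNat, Cond.Holds, NatExpr.eval, State.nat_writeNat, h0, u13, e13]
    · simp [nat_skip, Cond.Holds, NatExpr.eval, h0, u3, u16, e3, e16, h2]

theorem exec_update (s : State) :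
    (∀ e, (update.exec ans s).nat 5 e 0 = if e = s.nat 20 0 0 then 1 else s.nat 5 e 0) ∧
    ∀ i < s.nat 0 0 0, (update.exec ans s).nat 4 i 0 =
      if s.nat 1 (s.nat 20 0 0) i = s.nat 21 0 0 then s.nat 4 i 0 else 1 := by
  simp only [update, nat_seq]
  refine ⟨fun e => ?_, ?_⟩
  · rw [exec_nat _ (by decide)]
    simp [nat_setNat, State.nat_writeNat, NatExpr.eval]
  · have key := exec_loop (ans := ans) (a := 12) (x := .var 0)
      (s := (setNat 5 (.var 20) (.const 0) (.const 1)).exec ans s)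
      (body := .cond (.natLe (.add (.sub (.read 1 (.var 20) (.var 12)) (.var 21))
        (.sub (.var 21) (.read 1 (.var 20) (.var 12)))) (.const 0))
        .skip (.setNat 4 (.var 12) (.const 0) (.const 1)))
      (fun t s' => ∀ i, s'.nat 4 i 0 =
        if i < t ∧ s.nat 1 (s.nat 20 0 0) i ≠ s.nat 21 0 0 then 1 else s.nat 4 i 0)
      (by simp [State.nat_tick, nat_setNat, State.nat_writeNat]) (by
        rintro t - s' hn - h1 i
        have e1 := hn 1 (by decide)
        have e20 := congrFun (congrFun (hn 20 (by decide)) 0) 0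
        have e21 := congrFun (congrFun (hn 21 (by decide)) 0) 0
        replace e1 : s'.nat 1 = s.nat 1 := by
          rw [e1]
          exact exec_nat _ (by decide) s
        simp [nat_setNat, State.nat_writeNat, NatExpr.eval] at e20 e21
        have hk : ∀ a b : ℕ, a - b + (b - a) ≤ 0 ↔ a = b := by omega
        simp [State.nat_tick, nat_cond, nat_skip, nat_setNat, Cond.Holds, NatExpr.eval,
          State.nat_writeNat, e1, e20, e21, hk, h1]
        rcases lt_trichotomy i t with hit | rfl | hit
        · simp [hit.ne, hit, hit.le]
        · split_ifs <;> simp_all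
        · simp [hit.ne', hit.not_gt, hit.not_ge])
    simp [NatExpr.eval, nat_setNat, State.nat_writeNat] at key
    intro i hi
    rw [key]
    split_ifs <;> simp_all

/-! ### Memory contents versus the mathematical state -/

variable {m n k : ℕ}

/-- The memory holds the instance `I`, the set `E` of the tests performed and the set `K` of the
compatible hypotheses. -/
structure Represents (I : DRD m n k) (E : Finset (Fin n)) (K : Finset (Fin m)) (s : State) :
    Prop where
  dim_m : s.nat 0 0 0 = m
  dim_n : s.nat 0 0 1 = n
  dim_k : s.nat 0 0 2 = k
  test : ∀ (e : Fin n) (i : Fin m), s.nat 1 e i = if i ∈ I.test e then 1 else 0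
  region : ∀ (j : Fin k) (i : Fin m), s.nat 2 j i = if i ∈ I.region j then 1 else 0
  dead : ∀ i : Fin m, s.nat 4 i 0 = if i ∈ K then 0 else 1
  used : ∀ e : Fin n, s.nat 5 e 0 = if e ∈ E then 1 else 0
  prob : ∀ i : Fin m, s.real 0 i 0 = I.p i
  cost : ∀ e : Fin n, s.real 1 e 0 = I.cost e

variable {I : DRD m n k} {E : Finset (Fin n)} {K : Finset (Fin m)} {s s' : State}

theorem Represents.of_sameData (h : Represents I E K s) (hd : SameData s s') :
    Represents I E K s' where
  dim_m := by rw [hd.dim, h.dim_m]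
  dim_n := by rw [hd.dim, h.dim_n]
  dim_k := by rw [hd.dim, h.dim_k]
  test := by rw [hd.test]; exact h.test
  region := by rw [hd.region]; exact h.region
  dead := by rw [hd.dead]; exact h.dead
  used := by rw [hd.used]; exact h.used
  prob := by rw [hd.prob]; exact h.prob
  cost := by rw [hd.cost]; exact h.cost

theorem represents_initialState (I : DRD m n k) :
    Represents I ∅ univ I.initialState where
  dim_m := by simp [DRD.initialState]
  dim_n := by simp [DRD.initialState]
  dim_k := by simp [DRD.initialState]
  test e i := by simp [DRD.initialState, Fin.val_inj]
  region j i := by simp [DRD.initialState, Fin.val_inj]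
  dead i := by simp [DRD.initialState]
  used e := by simp [DRD.initialState]
  prob i := by simp [DRD.initialState]
  cost e := by simp [DRD.initialState]

theorem Represents.good_iff (h : Represents I E K s) (j : Fin k) :
    Good s j ↔ K ⊆ I.region j := by
  rw [Good, h.dim_m]
  constructor
  · intro hg i hi
    have := hg i i.2
    rw [h.dead, h.region, if_pos hi] at this
    simpa using this
  · intro hs i hi hc
    have h1 := h.dead ⟨i, hi⟩
    have h2 := h.region j ⟨i, hi⟩
    simp only [hc.1, hc.2] at h1 h2
    have h3 : (⟨i, hi⟩ : Fin m) ∈ K := by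
      by_contra hn
      simp [hn] at h1
    simp [hs h3] at h2

theorem Represents.exists_good_iff (h : Represents I E K s) :
    (∃ j < s.nat 0 0 2, Good s j) ↔ ∃ j, K ⊆ I.region j := by
  rw [h.dim_k]
  constructor
  · rintro ⟨j, hj, hg⟩
    exact ⟨⟨j, hj⟩, (h.good_iff ⟨j, hj⟩).1 hg⟩
  · rintro ⟨j, hj⟩
    exact ⟨j, j.2, (h.good_iff j).2 hj⟩

theorem Represents.yesCount_eq (h : Represents I E K s) (e : Fin n) :
    yesCount s e = (I.toASR.yesPart K e).card := by
  have : I.toASR.yesPart K e = univ.filter fun i => i ∈ K ∧ i ∈ I.test e := by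
    ext i
    simp [I.mem_yesPart]
  rw [yesCount, h.dim_m, sum_range, this, card_filter]
  refine sum_congr rfl fun i _ => if_congr ?_ rfl rfl
  rw [h.dead, h.test]
  split_ifs <;> simp_all

theorem Represents.noCount_eq (h : Represents I E K s) (e : Fin n) :
    noCount s e = (I.toASR.noPart K e).card := by
  have : I.toASR.noPart K e = univ.filter fun i => i ∈ K ∧ i ∉ I.test e := by
    ext i
    simp [I.mem_noPart]
  rw [noCount, h.dim_m, sum_range, this, card_filter]
  refine sum_congr rfl fun i _ => if_congr ?_ rfl rfl
  rw [h.dead, h.test]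
  split_ifs <;> simp_all

theorem Represents.yesWeight_eq (h : Represents I E K s) (e : Fin n) :
    yesWeight s e = ∑ i ∈ I.toASR.yesPart K e, I.p i := by
  have : I.toASR.yesPart K e = univ.filter fun i => i ∈ K ∧ i ∈ I.test e := by
    ext i
    simp [I.mem_yesPart]
  rw [yesWeight, h.dim_m, sum_range, this, sum_filter]
  refine sum_congr rfl fun i _ => if_congr ?_ (h.prob i) rfl
  rw [h.dead, h.test]
  split_ifs <;> simp_all

theorem Represents.noWeight_eq (h : Represents I E K s) (e : Fin n) :
    noWeight s e = ∑ i ∈ I.toASR.noPart K e, I.p i := by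
  have : I.toASR.noPart K e = univ.filter fun i => i ∈ K ∧ i ∉ I.test e := by
    ext i
    simp [I.mem_noPart]
  rw [noWeight, h.dim_m, sum_range, this, sum_filter]
  refine sum_congr rfl fun i _ => if_congr ?_ (h.prob i) rfl
  rw [h.dead, h.test]
  split_ifs <;> simp_all

theorem Represents.outsideVal_eq (h : Represents I E K s) (j : Fin k) :
    outsideVal s j = ((K \ I.region j).card : ℝ) := by
  have : K \ I.region j = univ.filter fun i => i ∈ K ∧ i ∉ I.region j := by
    ext i
    simp
  rw [outsideVal, h.dim_m, sum_range, this, card_filter, Nat.cast_sum]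
  refine sum_congr rfl fun i _ => ?_
  rw [h.dead, h.region, Nat.cast_ite, Nat.cast_one, Nat.cast_zero]
  refine if_congr ?_ rfl rfl
  split_ifs <;> simp_all

theorem Represents.agreeVal_eq (h : Represents I E K s) (hK : I.IsVersionSpace E K)
    (e : Fin n) {i : Fin m} (hi : i ∈ K) (j : Fin k) :
    agreeVal s e i j = ((I.compatible i (insert e E) \ I.region j).card : ℝ) := by
  have : I.compatible i (insert e E) \ I.region j =
      univ.filter fun h => (h ∈ K ∧ h ∉ I.region j) ∧ (h ∈ I.test e ↔ i ∈ I.test e) := by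
    ext h
    rw [mem_sdiff, I.mem_compatible_insert, hK i hi, mem_filter]
    simp only [mem_univ, true_and]
    tauto
  rw [agreeVal, h.dim_m, sum_range, this, card_filter, Nat.cast_sum]
  refine sum_congr rfl fun i _ => ?_
  rw [h.dead, h.region, h.test, h.test, Nat.cast_ite, Nat.cast_one, Nat.cast_zero]
  refine if_congr ?_ rfl rfl
  split_ifs <;> simp_all

/-- In the ratio of uncovered parts the denominators `|D_jᶜ|` cancel, so each factor is a quotient
of two counts inside the version space. -/
theorem Represents.one_sub_factorVal (h : Represents I E K s) (hK : I.IsVersionSpace E K)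
    (hc : ¬ ∃ j, K ⊆ I.region j) (e : Fin n) {i : Fin m} (hi : i ∈ K) :
    1 - factorVal s e i =
      (I.orFun i (insert e E) - I.orFun i E) / (1 - I.orFun i E) := by
  have hpos : 0 < 1 - I.orFun i E := sub_pos.2 (hK.orFun_lt_one hc hi)
  have h1 : factorVal s e i = (1 - I.orFun i (insert e E)) / (1 - I.orFun i E) := by
    rw [I.one_sub_orFun, I.one_sub_orFun, ← prod_div_distrib, factorVal, h.dim_k, prod_range,
      DRD.regionsOf, prod_filter]
    refine prod_congr rfl fun j _ => ?_
    have hq : ((I.region j)ᶜ.card : ℝ) ≠ 0 := by exact_mod_cast (I.card_compl_region_pos j).ne'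
    rw [h.agreeVal_eq hK e hi, h.outsideVal_eq, h.region, DRD.remaining, DRD.remaining, hK i hi,
      div_div_div_cancel_right₀ hq]
    exact if_congr (by split_ifs <;> simp_all) rfl rfl
  rw [h1]
  field_simp
  ring

/-- A side of minimum cardinality of the split of `K` by `e`. -/
def minSide (I : DRD m n k) (K : Finset (Fin m)) (e : Fin n) : Finset (Fin m) :=
  if (I.toASR.yesPart K e).card ≤ (I.toASR.noPart K e).card then I.toASR.yesPart K e
  else I.toASR.noPart K e

theorem isMinSide_minSide (I : DRD m n k) (K : Finset (Fin m)) (e : Fin n) :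
    I.toASR.IsMinSide K e (minSide I K e) := by
  unfold minSide
  split_ifs with h
  · exact .inl ⟨rfl, h⟩
  · exact .inr ⟨rfl, by omega⟩

theorem Represents.scoreVal_eq (h : Represents I E K s) (hK : I.IsVersionSpace E K)
    (hc : ¬ ∃ j, K ⊆ I.region j) (e : Fin n) :
    scoreVal s e = I.toASR.score E K e (minSide I K e) := by
  have h1 : smallVal s e = ∑ i ∈ minSide I K e, I.p i := by
    rw [smallVal, h.yesCount_eq, h.noCount_eq, h.yesWeight_eq, h.noWeight_eq, minSide,
      apply_ite fun L => ∑ i ∈ L, I.p i]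
  have h2 : gainsVal s e = ∑ i ∈ K,
      I.p i * ((I.orFun i (insert e E) - I.orFun i E) / (1 - I.orFun i E)) := by
    rw [gainsVal, h.dim_m, sum_range, ← sum_subset (subset_univ K)]
    · refine sum_congr rfl fun i hi => ?_
      rw [h.dead, if_pos hi, if_pos rfl, h.prob, h.one_sub_factorVal hK hc e hi]
    · intro i _ hi
      rw [h.dead, if_neg hi, if_neg one_ne_zero]
  rw [scoreVal, h1, h2, h.cost, div_eq_inv_mul, ← one_div]
  rfl

/-- All tests together cover every hypothesis. Hence an uncovered state still has a candidate test,
and `n` rounds are enough. -/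
theorem card_lt_of_not_covered (hK : I.IsVersionSpace E K) (hc : ¬ ∃ j, K ⊆ I.region j) :
    E.card < n := by
  by_contra hn
  have hE : E = univ := by
    rw [← card_eq_iff_eq_univ, Fintype.card_fin]
    exact le_antisymm ((card_le_univ E).trans_eq (Fintype.card_fin n)) (not_lt.1 hn)
  obtain ⟨i, hi⟩ := I.nonempty_of_not_covered hc
  exact (hK.orFun_lt_one hc hi).ne (hE ▸ I.orFun_univ i)

theorem Represents.isGreedyChoice (h : Represents I E K s) (hK : I.IsVersionSpace E K)
    (hc : ¬ ∃ j, K ⊆ I.region j) (ans : ℕ → Bool) :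
    ∃ e : Fin n, (findTest.exec ans s).nat 20 0 0 = e ∧ I.toASR.IsGreedyChoice E K e := by
  have hex : ∃ e < s.nat 0 0 1, s.nat 5 e 0 = 0 := by
    have hlt : E.card < Fintype.card (Fin n) := by
      rw [Fintype.card_fin]
      exact card_lt_of_not_covered hK hc
    obtain ⟨e, he⟩ : ∃ e, e ∉ E := by
      by_contra! hall
      rw [eq_univ_of_forall hall, card_univ] at hlt
      exact lt_irrefl _ hlt
    exact ⟨e, h.dim_n.symm ▸ e.2, by rw [h.used, if_neg he]⟩
  obtain ⟨h1, h2, h3⟩ := exec_findTest (ans := ans) s hex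
  rw [h.dim_n] at h1 h3
  refine ⟨⟨_, h1⟩, rfl, fun hE => ?_, minSide I K, fun e _ => isMinSide_minSide I K e,
    fun e he => ?_⟩
  · have := h.used ⟨_, h1⟩
    rw [if_pos hE] at this
    exact zero_ne_one (h2.symm.trans this)
  · rw [← h.scoreVal_eq hK hc, ← h.scoreVal_eq hK hc]
    exact h3 e e.2 (by rw [h.used, if_neg he])

/-! ### From rounds of the program to a greedy policy -/

/-- The outcomes of the tests as a function of the number of the test. -/
def extend (ans : Fin n → Bool) (x : ℕ) : Bool := if h : x < n then ans ⟨x, h⟩ else false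

theorem extend_val (ans : Fin n → Bool) (e : Fin n) : extend ans e = ans e := by
  simp [extend]

theorem exec_round_covered (ans : ℕ → Bool) (hc : ∃ j < s.nat 0 0 2, Good s j) :
    SameData s (round.exec ans s) ∧ (round.exec ans s).log = s.log := by
  have h16 := (exec_findRegion (ans := ans) s).2.2.2 hc
  have hd : SameData s (findRegion.exec ans s) := .exec (by decide) (by decide) s
  have hl := exec_log (ans := ans) findRegion (by decide) s
  rw [round, exec_seq, exec_cond_of_holds]
  · exact ⟨hd.trans ⟨rfl, rfl, rfl, rfl, rfl, rfl, rfl⟩, hl⟩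
  · simp [Cond.Holds, NatExpr.eval, h16]

theorem exec_round_query (ans : ℕ → Bool) (hc : ¬ ∃ j < s.nat 0 0 2, Good s j) :
    ∃ t, round.exec ans s = (update.exec ans ((perform 21 (.var 20)).exec ans
      (findTest.exec ans (findRegion.exec ans s)))).tick t := by
  have h16 := exec_findRegion (ans := ans) s
  rw [← h16.2.2] at hc
  have h0 := h16.2.1.resolve_right hc
  rw [round, exec_seq, exec_cond_of_not_holds]
  · rw [exec_seq, exec_seq]
    exact ⟨_, by simp only [State.tick, Nat.add_assoc]; rfl⟩
  · simp [Cond.Holds, NatExpr.eval, h0]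

theorem SameData.tick (h : SameData s s') (t : ℕ) : SameData s (s'.tick t) :=
  h.trans ⟨rfl, rfl, rfl, rfl, rfl, rfl, rfl⟩

/-- A round consults the answers only at its selected test, so agreement there suffices. -/
theorem exec_round_congr {ans ans' : ℕ → Bool}
    (h : ans ((findTest.exec ans (findRegion.exec ans s)).nat 20 0 0) =
      ans' ((findTest.exec ans (findRegion.exec ans s)).nat 20 0 0)) :
    round.exec ans s = round.exec ans' s := by
  have h1 : findRegion.exec ans' s = findRegion.exec ans s := exec_congr _ (by decide) s
  have h2 : ∀ u, findTest.exec ans' u = findTest.exec ans u := exec_congr _ (by decide)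
  have h3 : ∀ u, update.exec ans' u = update.exec ans u := exec_congr _ (by decide)
  have hp : (perform 21 (.var 20)).exec ans (findTest.exec ans (findRegion.exec ans s)) =
      (perform 21 (.var 20)).exec ans' (findTest.exec ans (findRegion.exec ans s)) := by
    have h' : ans ((NatExpr.var 20).eval (findTest.exec ans (findRegion.exec ans s))) =
      ans' ((NatExpr.var 20).eval (findTest.exec ans (findRegion.exec ans s))) := h
    rw [exec, exec, h']
  rw [round, exec_seq, exec_seq, h1]
  by_cases hb : Cond.Holds (findRegion.exec ans s) (.natLe (.const 1) (.var 16))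
  · rw [exec_cond_of_holds hb, exec_cond_of_holds hb]
    rfl
  · rw [exec_cond_of_not_holds hb, exec_cond_of_not_holds hb]
    simp only [exec_seq, h2, h3, hp]

theorem Represents.exec_round_query (h : Represents I E K s) (hK : I.IsVersionSpace E K)
    (hc : ¬ ∃ j, K ⊆ I.region j) (ans : ℕ → Bool) :
    ∃ e : Fin n, (findTest.exec ans (findRegion.exec ans s)).nat 20 0 0 = e ∧
      I.toASR.IsGreedyChoice E K e ∧ (round.exec ans s).log = s.log ++ [(e : ℕ)] ∧
      Represents I (insert e E)
        (if ans e then I.toASR.yesPart K e else I.toASR.noPart K e) (round.exec ans s) := by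
  have hd : SameData s (findTest.exec ans (findRegion.exec ans s)) :=
    (SameData.exec (by decide) (by decide) s).trans (SameData.exec (by decide) (by decide) _)
  obtain ⟨e, he, hg⟩ := (h.of_sameData
    (SameData.exec (P := findRegion) (ans := ans) (by decide) (by decide) s)).isGreedyChoice
      hK hc ans
  refine ⟨e, he, hg, ?_⟩
  obtain ⟨t, ht⟩ := Greedy.exec_round_query (s := s) ans (mt h.exists_good_iff.1 hc)
  have hlog : (findTest.exec ans (findRegion.exec ans s)).log = s.log := by
    rw [exec_log _ (by decide), exec_log _ (by decide)]
  rw [ht]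
  generalize findTest.exec ans (findRegion.exec ans s) = v at he hd hlog
  have hw : SameData s ((perform 21 (.var 20)).exec ans v) :=
    hd.trans (SameData.exec (by decide) (by decide) v)
  have h20 : ((perform 21 (.var 20)).exec ans v).nat 20 0 0 = e := by
    rw [exec_nat _ (by decide), he]
  have h21 : ((perform 21 (.var 20)).exec ans v).nat 21 0 0 = if ans e then 1 else 0 := by
    simp [exec, State.writeNat, State.tick, NatExpr.eval, he]
  have hwlog : ((perform 21 (.var 20)).exec ans v).log = s.log ++ [(e : ℕ)] := by
    simp [exec, NatExpr.eval, he, hlog]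
  generalize (perform 21 (.var 20)).exec ans v = w at hw h20 h21 hwlog
  have hr := h.of_sameData hw
  obtain ⟨hu5, hu4⟩ := exec_update (ans := ans) w
  rw [h20] at hu5 hu4
  rw [h21, hr.dim_m] at hu4
  have hn : ∀ b ∉ update.natArrays, (update.exec ans w).nat b = w.nat b :=
    fun b hb => exec_nat _ hb w
  refine ⟨(exec_log update (by decide) w).trans hwlog, ?_⟩
  constructor
  · rw [State.nat_tick, hn 0 (by decide), hr.dim_m]
  · rw [State.nat_tick, hn 0 (by decide), hr.dim_n]
  · rw [State.nat_tick, hn 0 (by decide), hr.dim_k]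
  · rw [State.nat_tick, hn 1 (by decide)]
    exact hr.test
  · rw [State.nat_tick, hn 2 (by decide)]
    exact hr.region
  · intro i
    rw [State.nat_tick, hu4 i i.2, hr.test, hr.dead]
    cases ans e <;> by_cases h1 : i ∈ K <;> by_cases h2 : i ∈ I.test e <;>
      simp [h1, h2, I.mem_yesPart, I.mem_noPart]
  · intro e'
    rw [State.nat_tick, hu5, hr.used]
    by_cases h1 : e' = e <;> simp [h1, Fin.val_inj]
  · rw [State.real_tick, exec_real _ (by decide)]
    exact hr.prob
  · rw [State.real_tick, exec_real _ (by decide)]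
    exact hr.cost

/-- The body of the main loop. -/
def loopStep (ans : ℕ → Bool) (s : State) (t : ℕ) : State :=
  round.exec ans ((s.writeNat 10 0 0 t).tick 1)

theorem foldl_loopStep_covered (ans : ℕ → Bool) (l : List ℕ)
    (hc : ∃ j < s.nat 0 0 2, Good s j) :
    SameData s (l.foldl (loopStep ans) s) ∧ (l.foldl (loopStep ans) s).log = s.log := by
  refine foldl_rel (fun s s' : State => (∃ j < s.nat 0 0 2, Good s j) →
    SameData s s' ∧ s'.log = s.log) (fun s _ => ⟨⟨rfl, rfl, rfl, rfl, rfl, rfl, rfl⟩, rfl⟩)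
    (fun s t u h1 h2 h => ?_) _ (fun s t h => ?_) l s hc
  · obtain ⟨hd, hl⟩ := h1 h
    obtain ⟨hd', hl'⟩ := h2 (by rwa [hd.good, hd.dim])
    exact ⟨hd.trans hd', hl'.trans hl⟩
  · have hd : SameData s ((s.writeNat 10 0 0 t).tick 1) :=
      (SameData.writeNat ⟨rfl, rfl, rfl, rfl, rfl, rfl, rfl⟩ (by decide) t).tick 1
    obtain ⟨hd', hl'⟩ := exec_round_covered (s := (s.writeNat 10 0 0 t).tick 1) ans
      (by rwa [hd.good, hd.dim])
    exact ⟨hd.trans hd', hl'⟩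

theorem Represents.exists_policy_of_covered (h : Represents I E K s)
    (hK : I.IsVersionSpace E K) (hc : ∃ j, K ⊆ I.region j) (l : List ℕ) :
    ∃ T, I.IsGreedy E K T ∧ ∀ a : Fin n → Bool,
      (findRegion.exec (extend a) (l.foldl (loopStep (extend a)) s)).log =
        s.log ++ (T.path a).map (fun e => (e : ℕ)) ∧
      (findRegion.exec (extend a) (l.foldl (loopStep (extend a)) s)).nat 3 0 0 =
        T.decision a := by
  have hc' := h.exists_good_iff.2 hc
  have hlast := lastBelow_spec hc'
  have hlt : lastBelow (Good s) (s.nat 0 0 2) < k := hlast.1.trans_eq h.dim_k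
  refine ⟨.report ⟨_, hlt⟩, .report E K _ (hK.uncovered_eq_empty hc)
    ((h.good_iff ⟨_, hlt⟩).1 hlast.2), fun a => ?_⟩
  obtain ⟨hd, hl⟩ := foldl_loopStep_covered (extend a) l hc'
  refine ⟨?_, ?_⟩
  · rw [exec_log _ (by decide), hl]
    simp [Policy.path]
  · rw [(exec_findRegion _).1, hd.good, hd.dim]
    rfl

/-- From a state that represents `E` and `K`, sufficiently many rounds carry out a greedy
policy. -/
theorem Represents.exists_policy (l : List ℕ) :
    ∀ {E : Finset (Fin n)} {K : Finset (Fin m)} {s : State}, Represents I E K s →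
      I.IsVersionSpace E K → n ≤ E.card + l.length →
      ∃ T, I.IsGreedy E K T ∧ ∀ a : Fin n → Bool,
        (findRegion.exec (extend a) (l.foldl (loopStep (extend a)) s)).log =
          s.log ++ (T.path a).map (fun e => (e : ℕ)) ∧
        (findRegion.exec (extend a) (l.foldl (loopStep (extend a)) s)).nat 3 0 0 =
          T.decision a := by
  induction l with
  | nil =>
    intro E K s h hK hn
    refine h.exists_policy_of_covered hK ?_ []
    by_contra hc
    -- With no rounds left `E` has at least `n` elements, so the state must be covered.
    exact absurd (card_lt_of_not_covered hK hc) (not_lt.2 hn)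
  | cons t l ih =>
    intro E K s h hK hn
    by_cases hc : ∃ j, K ⊆ I.region j
    · exact h.exists_policy_of_covered hK hc (t :: l)
    have hs1 : Represents I E K ((s.writeNat 10 0 0 t).tick 1) := h.of_sameData
      ((SameData.writeNat ⟨rfl, rfl, rfl, rfl, rfl, rfl, rfl⟩ (by decide) t).tick 1)
    have hlog : ((s.writeNat 10 0 0 t).tick 1).log = s.log := rfl
    have hfold : ∀ ans, (t :: l).foldl (loopStep ans) s =
        l.foldl (loopStep ans) (round.exec ans ((s.writeNat 10 0 0 t).tick 1)) := fun _ => rfl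
    simp only [hfold]
    generalize (s.writeNat 10 0 0 t).tick 1 = s1 at hs1 hlog
    -- The selected test does not depend on the answers, so the two hypothetical rounds with
    -- constant answers `true` and `false` query the same test and provide the two subtrees.
    have hcongr : ∀ ans : ℕ → Bool, (findTest.exec ans (findRegion.exec ans s1)) =
        findTest.exec (fun _ => true) (findRegion.exec (fun _ => true) s1) := fun ans => by
      rw [exec_congr findTest (by decide), exec_congr findRegion (by decide)]
    obtain ⟨e, he, hg, hlog1, hr1⟩ := hs1.exec_round_query hK hc fun _ => true
    obtain ⟨e', he', -, hlog0, hr0⟩ := hs1.exec_round_query hK hc fun _ => false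
    obtain rfl : e' = e := by
      rw [hcongr, he] at he'
      exact (Fin.ext he').symm
    have hcard : n ≤ (insert e' E).card + l.length := by
      rw [card_insert_of_notMem hg.1]
      rw [List.length_cons] at hn
      omega
    rw [if_pos rfl] at hr1
    rw [if_neg Bool.false_ne_true] at hr0
    obtain ⟨T1, hT1, hrun1⟩ := ih hr1 (hK.yesPart e') hcard
    obtain ⟨T0, hT0, hrun0⟩ := ih hr0 (hK.noPart e') hcard
    refine ⟨.query e' T1 T0, .query E K e' T1 T0 ?_ ?_ hT1 hT0, fun a => ?_⟩
    · rw [hK.uncovered_eq hc]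
      exact I.nonempty_of_not_covered hc
    · rwa [hK.uncovered_eq hc]
    -- The actual round agrees with the hypothetical one whose constant answer is the true outcome
    -- of the selected test.
    · have hround : round.exec (extend a) s1 = round.exec (fun _ => a e') s1 :=
        exec_round_congr (by rw [hcongr, he, extend_val])
      rw [hround]
      cases hae : a e'
      · rw [(hrun0 a).1, (hrun0 a).2, hlog0, hlog]
        simp [Policy.path, Policy.decision, hae]
      · rw [(hrun1 a).1, (hrun1 a).2, hlog1, hlog]
        simp [Policy.path, Policy.decision, hae]

theorem exists_implements (I : DRD m n k) :
    ∃ T : Policy n k, I.IsGreedyPolicy T ∧ I.Implements program T := by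
  have h : Represents I ∅ univ
      (I.initialState.tick ((NatExpr.read 0 (.const 0) (.const 1)).time + 1)) :=
    (represents_initialState I).of_sameData
      (SameData.tick ⟨rfl, rfl, rfl, rfl, rfl, rfl, rfl⟩ _)
  obtain ⟨T, hT, hrun⟩ := h.exists_policy (List.range n) I.isVersionSpace_root (by simp)
  refine ⟨T, hT, fun i => ?_⟩
  have hx : NatExpr.eval I.initialState (.read 0 (.const 0) (.const 1)) = n :=
    (represents_initialState I).dim_n
  have hexec : I.run program i = (findRegion.exec (extend (I.outcome i))
      ((List.range n).foldl (loopStep (extend (I.outcome i)))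
        (I.initialState.tick ((NatExpr.read 0 (.const 0) (.const 1)).time + 1)))).tick 1 := by
    rw [DRD.run, program, exec, exec_tick, exec_tick, exec, hx]
    rfl
  rw [hexec, State.log_tick, State.nat_tick, (hrun _).1, (hrun _).2]
  exact ⟨List.nil_append _, rfl⟩

/-! ### Running time and conclusion -/

theorem dimBounded_program : program.dimBounded := by
  simp [program, round, findRegion, findTest, computeScore, smallSide, addGains, remainingFactor,
    countOutside, update, dimBounded]

theorem steps_run_le (I : DRD m n k) (i : Fin m) :
    (I.run program i).steps ≤ program.size * (m + n + k) ^ program.depth := by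
  have h2 := I.two_le_card
  have h := steps_exec_le (ans := fun x => if h : x < n then I.outcome i ⟨x, h⟩ else false)
    dimBounded_program (N := m + n + k) (by omega) (s := I.initialState) (fun c => by
      simp only [DRD.initialState]
      split_ifs <;> simp_all <;> omega)
  exact h.trans_eq (Nat.zero_add _)

end Greedy

namespace DRD

variable {m n k : ℕ}

/-- Double counting of the pairs `(i, j)` with `i ∈ D_j`: each region has at least one, each
hypothesis at most `r`. -/
theorem card_regions_le (I : DRD m n k) (h : ∀ j, (I.region j).Nonempty) :
    k ≤ m * I.maxOverlap := by
  calc k = ∑ _j : Fin k, 1 := by simp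
    _ ≤ ∑ j : Fin k, (I.region j).card :=
        Finset.sum_le_sum fun j _ => Finset.card_pos.2 (h j)
    _ = ∑ i : Fin m, (I.regionsOf i).card := by
        simp only [Finset.card_eq_sum_ones, regionsOf, Finset.sum_filter]
        rw [Finset.sum_comm]
        refine Finset.sum_congr rfl fun j _ => ?_
        simp
    _ ≤ ∑ _i : Fin m, I.maxOverlap := Finset.sum_le_sum fun i _ => I.card_regionsOf_le i
    _ = m * I.maxOverlap := by simp

/-- Trades the base for its square root at twice the exponent, with one constant as factor and
exponent. It serves to replace `k ≤ m r` by `r`, as then `m + n + k ≤ (m + n + r) ^ 2`. -/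
theorem mul_pow_le_mul_pow {a b x y : ℕ} (hy : 1 ≤ y) (hxy : x ≤ y ^ 2) :
    a * x ^ b ≤ (a + 2 * b) * y ^ (a + 2 * b) := by
  refine Nat.mul_le_mul (by omega) ((Nat.pow_le_pow_left hxy b).trans ?_)
  rw [← pow_mul]
  exact Nat.pow_le_pow_right hy (by omega)

end DRD

end

theorem mainTheorem7 :
    ∃ (C : ℝ) (c : ℕ) (P : RealRAM.Program), ∀ (m n k : ℕ) (I : DRD m n k),
      -- the OR-combinations form an instance of adaptive submodular ranking
      I.toASR.IsInstance ∧
      -- covering a hypothesis means determining a region that contains it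
      (∀ (i : Fin m) (S : Finset (Fin n)),
        I.orFun i S = 1 ↔ ∃ j, i ∈ I.region j ∧ I.compatible i S ⊆ I.region j) ∧
      -- the smallest positive increment is at least `m ^ (-r)`
      ((m : ℝ) ^ I.maxOverlap)⁻¹ ≤ I.toASR.minIncrement ∧
      -- the greedy algorithm is an `O(r log m)`-approximation
      (∀ T : Policy n k, I.IsGreedyPolicy T →
        I.IsFeasible T ∧
        ∀ T' : Policy n k, I.IsFeasible T' →
          I.expectedCost T ≤ C * (I.maxOverlap * Real.log m) * I.expectedCost T') ∧
      -- the greedy algorithm runs in polynomial time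
      ∃ T : Policy n k, I.IsGreedyPolicy T ∧ I.Implements P T ∧
        ∀ i : Fin m, (I.run P i).steps ≤ c * (m + n + k) ^ c ∧
          ((∀ j, (I.region j).Nonempty) →
            (I.run P i).steps ≤ c * (m + n + I.maxOverlap) ^ c) := by
  refine ⟨4 * (1 + 2 / Real.log 2), Greedy.program.size + 2 * Greedy.program.depth,
    Greedy.program, fun m n k I => ⟨I.isInstance_toASR, I.orFun_eq_one_iff,
      I.inv_pow_le_minIncrement, fun T hT => ⟨?_, fun T' hT' => ?_⟩, ?_⟩⟩
  · exact fun i => DRD.isFeasible_of_isGreedy hT i (Finset.mem_univ i)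
  · exact DRD.expectedCost_le_of_isGreedyPolicy hT hT'
  · obtain ⟨T, hT, hP⟩ := Greedy.exists_implements I
    have hm := I.two_le_card
    refine ⟨T, hT, hP, fun i => ⟨?_, fun hne => ?_⟩⟩
    · exact (Greedy.steps_run_le I i).trans
        (DRD.mul_pow_le_mul_pow (by omega) (Nat.le_self_pow two_ne_zero _))
    · refine (Greedy.steps_run_le I i).trans (DRD.mul_pow_le_mul_pow (by omega) ?_)
      have hk := I.card_regions_le hne
      nlinarith [Nat.zero_le n, Nat.zero_le I.maxOverlap]
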